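/- Let $N\ge 0$, $\hbar>0$, let $I\subseteq\mathbb R$ be a set of times, and let $\mathbf p,\mathbf x\in\mathbb R^N$. Let $\hat\rho(t)$ be operators on $L^2(\mathbb R^N)$ (for instance density operators) with Schwartz kernels $\rho_t(\mathbf x',\mathbf x'')$ that satisfy, for $t\in I$, the master equation $$\partial_t\hat\rho=\tfrac{i}{\hbar}[\hat\rho,\hat H]+\tfrac12\sum_k\big([\hat L_k\hat\rho,\hat L_k^\dagger]+\text{h.c.}\big),$$ where the sum is finite, the time derivative is taken in the sense of tempered distributions (with respect to $t\in I$), and $\hat H=\hat H(t)$, $\hat L_k=\hat L_k(t)$ are arbitrary polynomials in $\hat x_n=x_n$, $\hat p_n=-i\hbar\,\partial/\partial x_n$, $\hat H$ being Hermitian; denote their Weyl symbols (polynomials in $\mathbf p,\mathbf x$) by $H$, $L_k$. Let $$W(\mathbf p,\mathbf x)=\frac1{(2\pi\hbar)^N}\int_{\mathbb R^N}\rho_t\big(\mathbf x+\tfrac{\boldsymbol\lambda}2,\mathbf x-\tfrac{\boldsymbol\lambda}2\big)e^{-i\mathbf p\cdot\boldsymbol\lambda/\hbar}\,d^N\boldsymbol\lambda$$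 be the Wigner function, and let the Wigner flow $J^W=(J^W_{\mathbf p},J^W_{\mathbf x})$ be $$J^W_{\mathbf p}=-W\circledast\frac{\partial H}{\partial\mathbf x}+\sum_k\Big(\tfrac{i\hbar}2(L_k\star W)\circledast\frac{\partial L_k^*}{\partial\mathbf x}+\text{c.c.}\Big),\qquad J^W_{\mathbf x}=W\circledast\frac{\partial H}{\partial\mathbf p}-\sum_k\Big(\tfrac{i\hbar}2(L_k\star W)\circledast\frac{\partial L_k^*}{\partial\mathbf p}+\text{c.c.}\Big),$$ where $\star=\exp\big(\tfrac{i\hbar}2\Lambda\big)$, $\circledast=\operatorname{sinc}\big(\tfrac\hbar2\Lambda\big)$, $\operatorname{sinc}z=\sin z/z$, $\Lambda=\overleftarrow{\partial}_{\mathbf x}\cdot\overrightarrow{\partial}_{\mathbf p}-\overleftarrow{\partial}_{\mathbf p}\cdot\overrightarrow{\partial}_{\mathbf x}$, the arrows showing the direction of differentiation. Let $\sigma_{p_n},\sigma_{x_n}$ satisfy $\sigma_{p_n}\sigma_{x_n}>\hbar/2$ for all $n$, let $\mathcal K$ be the convolution on phase space with $$K(\delta\mathbf p,\delta\mathbf x)=\prod_{n=1}^N\frac1{2\pi\sigma_{p_n}\sigma_{x_n}}\exp\Big(-\frac{\delta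 p_n^2}{2\sigma_{p_n}^2}-\frac{\delta x_n^2}{2\sigma_{x_n}^2}\Big),$$ and let $Q=\mathcal K W$ be the generalized Husimi function. Then $W$ and the components of $J^W$ are integrable, the Husimi flow $J^H_{\mathbf p}=\mathcal K J^W_{\mathbf p}$, $J^H_{\mathbf x}=\mathcal K J^W_{\mathbf x}$ is differentiable, and for every $t\in I$ and every $(\mathbf p,\mathbf x)$ the continuity equation $$\partial_t Q(\mathbf p,\mathbf x)=-\nabla\cdot J^H(\mathbf p,\mathbf x)=-\frac{\partial}{\partial\mathbf p}\cdot J^H_{\mathbf p}-\frac{\partial}{\partial\mathbf x}\cdot J^H_{\mathbf x}$$ holds, the derivative in $t$ existing (relative to $I$). -/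

import Mathlib

open MeasureTheory
open scoped ComplexConjugate SchwartzMap

noncomputable section

namespace WignerHusimi

/-- Configuration space `ℝᴺ` (also used for momenta and for relative coordinates). -/
abbrev Config (N : ℕ) : Type := EuclideanSpace ℝ (Fin N)

/-- Phase space `ℝᴺ × ℝᴺ`; a point is `(p, x)`, momentum first. -/
abbrev Phase (N : ℕ) : Type := Config N × Config N

variable {N : ℕ}

/-- Partial derivative `∂f/∂pₙ` of a function on phase space. -/
def dp (n : Fin N) (f : Phase N → ℂ) (z : Phase N) : ℂ :=
  fderiv ℝ f z (EuclideanSpace.single n 1, 0)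

/-- Partial derivative `∂f/∂xₙ` of a function on phase space. -/
def dx (n : Fin N) (f : Phase N → ℂ) (z : Phase N) : ℂ :=
  fderiv ℝ f z (0, EuclideanSpace.single n 1)

/-- Divergence on phase space, `∑ₙ ∂(Jp)ₙ/∂pₙ + ∑ₙ ∂(Jx)ₙ/∂xₙ`. -/
def divergence (Jp Jx : Fin N → Phase N → ℂ) (z : Phase N) : ℂ :=
  ∑ n, dp n (Jp n) z + ∑ n, dx n (Jx n) z

/-! ### Operators, their Weyl symbols, and kernels of operators -/

/-- The function on phase space given by a polynomial in the variables `pₙ` (`Sum.inl n`) and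
`xₙ` (`Sum.inr n`), with real or complex coefficients. -/
def polySymbol {R : Type*} [CommSemiring R] [Algebra R ℂ]
    (a : MvPolynomial (Fin N ⊕ Fin N) R) (z : Phase N) : ℂ :=
  MvPolynomial.aeval (Sum.elim (fun n => ((z.1 n : ℝ) : ℂ)) (fun n => ((z.2 n : ℝ) : ℂ))) a

/-- The operator with Weyl symbol `a`, applied to a function `ψ` on `ℝᴺ`:
`(Âψ)(x) = (2πħ)⁻ᴺ ∫ dq ∫ dy a(q, (x + y)/2) exp(i q·(x - y)/ħ) ψ(y)`.
For a polynomial `a` and a Schwartz function `ψ` both integrals converge absolutely, and `Â` is a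
polynomial in `x̂ₙ = xₙ` and `p̂ₙ = -iħ ∂/∂xₙ`; all such polynomials arise in this way. -/
def weylOp (ħ : ℝ) (a : Phase N → ℂ) (ψ : Config N → ℂ) (x : Config N) : ℂ :=
  (1 / (2 * Real.pi * ħ : ℝ) ^ N : ℝ) *
    ∫ q : Config N, ∫ y : Config N,
      a (q, (1 / 2 : ℝ) • (x + y)) * Complex.exp (Complex.I * (inner ℝ q (x - y) / ħ : ℝ)) * ψ y

/-- The kernel of the adjoint of the operator with kernel `K`. -/
def kerAdjoint (K : Config N × Config N → ℂ) (w : Config N × Config N) : ℂ :=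
  conj (K (w.2, w.1))

/-- The kernel of `Â K̂`, where `Â` has Weyl symbol `a` and `K̂` has kernel `K`. -/
def opMulKer (ħ : ℝ) (a : Phase N → ℂ) (K : Config N × Config N → ℂ)
    (w : Config N × Config N) : ℂ :=
  weylOp ħ a (fun y => K (y, w.2)) w.1

/-- The Weyl symbol `z ↦ conj (a z)` of the adjoint of the operator with Weyl symbol `a`. -/
def symbolAdjoint (a : Phase N → ℂ) (z : Phase N) : ℂ := conj (a z)

/-- The kernel of `K̂ Â = (Â† K̂†)†`, where `Â` has Weyl symbol `a` and `K̂` has kernel `K`. -/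
def kerMulOp (ħ : ℝ) (K : Config N × Config N → ℂ) (a : Phase N → ℂ) :
    Config N × Config N → ℂ :=
  kerAdjoint (opMulKer ħ (symbolAdjoint a) (kerAdjoint K))

/-- The kernel of the commutator `[K̂, Â] = K̂ Â - Â K̂`. -/
def kerCommutator (ħ : ℝ) (K : Config N × Config N → ℂ) (a : Phase N → ℂ)
    (w : Config N × Config N) : ℂ :=
  kerMulOp ħ K a w - opMulKer ħ a K w

/-- The kernel of the right-hand side of the master equation,
`(i/ħ) [ρ̂, Ĥ] + ½ ∑ₖ ([L̂ₖ ρ̂, L̂ₖ†] + h.c.)`, for operators with Weyl symbols `H` and `L k`. -/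
def lindbladRHS {ι : Type*} [Fintype ι] (ħ : ℝ) (H : Phase N → ℂ) (L : ι → Phase N → ℂ)
    (ρ : Config N × Config N → ℂ) (w : Config N × Config N) : ℂ :=
  Complex.I / ħ * kerCommutator ħ ρ H w +
    1 / 2 * ∑ k, (kerCommutator ħ (opMulKer ħ (L k) ρ) (symbolAdjoint (L k)) w +
      kerAdjoint (kerCommutator ħ (opMulKer ħ (L k) ρ) (symbolAdjoint (L k))) w)

/-- The master equation `∂ρ̂/∂t = (i/ħ) [ρ̂, Ĥ] + ½ ∑ₖ ([L̂ₖ ρ̂, L̂ₖ†] + h.c.)` on a set `I` of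
times, for a family `ρ̂(t)` of operators with Schwartz kernels. The time derivative is taken in the
sense of tempered distributions; this is implied by differentiability in the trace norm, in the
Hilbert-Schmidt norm, or in the topology of the Schwartz space. -/
def MasterEquation {ι : Type*} [Fintype ι] (ħ : ℝ) (I : Set ℝ) (H : ℝ → Phase N → ℂ)
    (L : ι → ℝ → Phase N → ℂ) (ρ : ℝ → 𝓢(Config N × Config N, ℂ)) : Prop :=
  ∀ t ∈ I, ∀ Φ : 𝓢(Config N × Config N, ℂ),
    HasDerivWithinAt (fun s => ∫ w, ρ s w * Φ w)
      (∫ w, lindbladRHS ħ (H t) (fun k => L k t) (ρ t) w * Φ w) I t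

/-! ### Wigner function, star product and Wigner flow -/

/-- Wigner function `W(p,x) = (2πħ)⁻ᴺ ∫ ρ(x + ξ/2, x - ξ/2) exp(-i p·ξ/ħ) dξ` of the operator with
kernel `ρ`. -/
def wigner (ħ : ℝ) (ρ : Config N × Config N → ℂ) (z : Phase N) : ℂ :=
  (1 / (2 * Real.pi * ħ : ℝ) ^ N : ℝ) *
    ∫ ξ : Config N, ρ (z.2 + (1 / 2 : ℝ) • ξ, z.2 - (1 / 2 : ℝ) • ξ) *
      Complex.exp (-Complex.I * (inner ℝ z.1 ξ / ħ : ℝ))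

/-- `f Λˡ g` for the bidifferential operator `Λ = ∑ₙ (∂←ₓₙ ∂→ₚₙ - ∂←ₚₙ ∂→ₓₙ)`, where the left arrows
act on `f` and the right arrows act on `g`. -/
def poissonPow : ℕ → (Phase N → ℂ) → (Phase N → ℂ) → Phase N → ℂ
  | 0, f, g => fun z => f z * g z
  | l + 1, f, g => fun z =>
      ∑ n, (poissonPow l (dx n f) (dp n g) z - poissonPow l (dp n f) (dx n g) z)

/-- Moyal product `f ⋆ g = f exp((iħ/2) Λ) g`; the series is a finite sum if `f` or `g` is a
polynomial. -/
def moyal (ħ : ℝ) (f g : Phase N → ℂ) (z : Phase N) : ℂ :=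
  ∑' l : ℕ, (Complex.I * ħ / 2) ^ l / (l.factorial : ℂ) * poissonPow l f g z

/-- The product `f sinc((ħ/2) Λ) g` with `sinc u = sin u / u = ∑ⱼ (-1)ʲ u²ʲ / (2j+1)!`; the series is
a finite sum if `f` or `g` is a polynomial. -/
def sincProd (ħ : ℝ) (f g : Phase N → ℂ) (z : Phase N) : ℂ :=
  ∑' j : ℕ, (-1 : ℂ) ^ j * (ħ / 2 : ℂ) ^ (2 * j) / ((2 * j + 1).factorial : ℂ) *
    poissonPow (2 * j) f g z

/-- The `n`-th momentum component of the Wigner flow,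
`-W sinc ∂H/∂xₙ + ∑ₖ ((iħ/2) (Lₖ ⋆ W) sinc ∂Lₖ*/∂xₙ + c.c.)`. -/
def wignerFlowP {ι : Type*} [Fintype ι] (ħ : ℝ) (H : Phase N → ℂ) (L : ι → Phase N → ℂ)
    (W : Phase N → ℂ) (n : Fin N) (z : Phase N) : ℂ :=
  -sincProd ħ W (dx n H) z +
    ∑ k, (Complex.I * ħ / 2 * sincProd ħ (moyal ħ (L k) W) (dx n (symbolAdjoint (L k))) z +
      conj (Complex.I * ħ / 2 * sincProd ħ (moyal ħ (L k) W) (dx n (symbolAdjoint (L k))) z))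

/-- The `n`-th position component of the Wigner flow,
`W sinc ∂H/∂pₙ - ∑ₖ ((iħ/2) (Lₖ ⋆ W) sinc ∂Lₖ*/∂pₙ + c.c.)`. -/
def wignerFlowX {ι : Type*} [Fintype ι] (ħ : ℝ) (H : Phase N → ℂ) (L : ι → Phase N → ℂ)
    (W : Phase N → ℂ) (n : Fin N) (z : Phase N) : ℂ :=
  sincProd ħ W (dp n H) z -
    ∑ k, (Complex.I * ħ / 2 * sincProd ħ (moyal ħ (L k) W) (dp n (symbolAdjoint (L k))) z +
      conj (Complex.I * ħ / 2 * sincProd ħ (moyal ħ (L k) W) (dp n (symbolAdjoint (L k))) z))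

/-! ### Gaussian convolution and generalized Husimi function -/

/-- The Gaussian kernel
`∏ₙ (2π σpₙ σxₙ)⁻¹ exp(-δpₙ²/(2σpₙ²) - δxₙ²/(2σxₙ²))`. -/
def gaussKernel (σp σx : Fin N → ℝ) (δ : Phase N) : ℝ :=
  ∏ n, 1 / (2 * Real.pi * σp n * σx n) *
    Real.exp (-(δ.1 n) ^ 2 / (2 * σp n ^ 2) - (δ.2 n) ^ 2 / (2 * σx n ^ 2))

/-- Convolution of a function on phase space with the Gaussian kernel. -/
def gaussConv (σp σx : Fin N → ℝ) (f : Phase N → ℂ) (z : Phase N) : ℂ :=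
  ∫ z' : Phase N, f z' * (gaussKernel σp σx (z - z') : ℂ)

/-- Generalized Husimi function of the operator with kernel `ρ`. -/
def husimi (ħ : ℝ) (σp σx : Fin N → ℝ) (ρ : Config N × Config N → ℂ) : Phase N → ℂ :=
  gaussConv σp σx (wigner ħ ρ)

/-- The momentum components of the Husimi flow of the operator with kernel `ρ`. -/
def husimiFlowP {ι : Type*} [Fintype ι] (ħ : ℝ) (σp σx : Fin N → ℝ) (H : Phase N → ℂ)
    (L : ι → Phase N → ℂ) (ρ : Config N × Config N → ℂ) (n : Fin N) : Phase N → ℂ :=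
  gaussConv σp σx (wignerFlowP ħ H L (wigner ħ ρ) n)

/-- The position components of the Husimi flow of the operator with kernel `ρ`. -/
def husimiFlowX {ι : Type*} [Fintype ι] (ħ : ℝ) (σp σx : Fin N → ℝ) (H : Phase N → ℂ)
    (L : ι → Phase N → ℂ) (ρ : Config N × Config N → ℂ) (n : Fin N) : Phase N → ℂ :=
  gaussConv σp σx (wignerFlowX ħ H L (wigner ħ ρ) n)

end WignerHusimi

end

open MeasureTheory
open scoped ComplexConjugate SchwartzMap

noncomputable section

namespace WignerHusimi

open SchwartzMap
open scoped LineDeriv FourierTransform ContDiff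

variable {N : ℕ}

/-! The Wigner transform sends Schwartz kernels to Schwartz functions and turns operator algebra
into Moyal algebra. If `Â` has the polynomial Weyl symbol `a`, then `Â K̂` has Wigner function `a ⋆
W` (`exists_opMulKer`), the adjoint kernel has the conjugate Wigner function, and hence `K̂ Â` has
Wigner function `W ⋆ a` (`exists_kerMulOp`). It suffices to check this on generators. The operators
`x̂ₙ` and `p̂ₙ` act on Wigner functions as the Bopp operators `bopp`, and Weyl quantization and the
Moyal product obey the same rules when a symbol is multiplied by one more coordinate.

A commutator thus becomes a Moyal bracket. Antisymmetry of `Λ` leaves the odd part of the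
exponential, `2i sin(ħΛ/2) = iħ Λ sinc(ħΛ/2)`. Since mixed second derivatives agree, the single
factor `Λ` can be pulled out as a divergence (`moyal_commutator`). Applied to every commutator of
the master equation, this shows that the Wigner function of its right-hand side is minus the
divergence of the Wigner flow (`exists_lindbladRHS`, `divergence_wignerFlow`).

The master equation holds only against test functions, but that is enough after smoothing. The value
of `Q` at a point is `W` paired with a shifted Gaussian, a Schwartz function; by Fubini it is also
the kernel paired with another, fixed Schwartz function (`exists_integral_wigner_mul`). Testing the
master equation with that function differentiates `Q` in time. Finally, convolution with a Gaussian
commutes with the divergence (`gaussConv_divergence`). -/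

/-! ### A criterion for being a Schwartz function -/

section Criterion

variable {E ι : Type*} [NormedAddCommGroup E] [NormedSpace ℝ E] [Fintype ι]

/-- A class of bounded differentiable functions that is closed under multiplication by coordinates
and under partial derivatives consists of Schwartz functions. -/
theorem exists_schwartzMap_of_class {S : Set (E → ℂ)} (ℓ : ι → E →L[ℝ] ℝ) (v : ι → E)
    (hℓ : ∀ z, z = ∑ i, ℓ i z • v i) (hb : ∀ f ∈ S, ∃ C, ∀ z, ‖f z‖ ≤ C)
    (hm : ∀ f ∈ S, ∀ i, (fun z => (ℓ i z : ℂ) * f z) ∈ S) (hd : ∀ f ∈ S, Differentiable ℝ f)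
    (hv : ∀ f ∈ S, ∀ i, (fun z => fderiv ℝ f z (v i)) ∈ S) {f : E → ℂ} (hf : f ∈ S) :
    ∃ F : 𝓢(E, ℂ), ⇑F = f := by
  -- The full derivative is a sum of fixed linear maps applied to partial derivatives, which lie in
  -- `S` again; smoothness and decay of the derivative therefore reduce to those of members of `S`.
  have hfd : ∀ f ∈ S, fderiv ℝ f = fun z => ∑ i,
      (ContinuousLinearMap.smulRightL ℝ E ℂ (ℓ i) ∘ fun z => fderiv ℝ f z (v i)) z := by
    intro f _
    ext z w
    conv_lhs => rw [hℓ w, map_sum]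
    simp
  have hc : ∀ n : ℕ, ∀ f ∈ S, ContDiff ℝ n f := by
    intro n
    induction n with
    | zero => exact fun f h => contDiff_zero.2 (hd f h).continuous
    | succ n ih =>
      intro f h
      rw [show ((n + 1 : ℕ) : WithTop ℕ∞) = (n : WithTop ℕ∞) + 1 by push_cast; rfl,
        contDiff_succ_iff_fderiv]
      refine ⟨hd f h, by simp, ?_⟩
      rw [hfd f h]
      exact ContDiff.sum fun i _ => (ContinuousLinearMap.contDiff _).comp (ih _ (hv f h i))
  have hnorm : ∀ z : E, ‖z‖ ≤ ∑ i, |ℓ i z| * ‖v i‖ := fun z => by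
    conv_lhs => rw [hℓ z]
    exact (norm_sum_le _ _).trans_eq (by simp [norm_smul])
  -- Each factor `‖z‖` is traded, through `hnorm`, for multiplications by coordinates, which stay
  -- inside `S`.
  have h0 : ∀ k : ℕ, ∀ f ∈ S, ∃ C, ∀ z, ‖z‖ ^ k * ‖f z‖ ≤ C := by
    intro k
    induction k with
    | zero => simpa using hb
    | succ k ih =>
      intro f h
      choose C hC using fun i => ih _ (hm f h i)
      refine ⟨∑ i, C i * ‖v i‖, fun z => ?_⟩
      calc ‖z‖ ^ (k + 1) * ‖f z‖ = ‖z‖ ^ k * ‖f z‖ * ‖z‖ := by ring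
        _ ≤ ‖z‖ ^ k * ‖f z‖ * ∑ i, |ℓ i z| * ‖v i‖ := by gcongr; exact hnorm z
        _ = ∑ i, (‖z‖ ^ k * ‖(ℓ i z : ℂ) * f z‖) * ‖v i‖ := by
          rw [Finset.mul_sum]
          refine Finset.sum_congr rfl fun i _ => ?_
          simp only [norm_mul, Complex.norm_real, Real.norm_eq_abs]
          ring
        _ ≤ _ := by gcongr with i; exact hC i z
  refine ⟨⟨f, contDiff_infty.2 fun n => hc n f hf, fun k n => ?_⟩, rfl⟩
  induction n generalizing f with
  | zero => simpa using h0 k f hf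
  | succ n ih =>
    choose C hC using fun i => ih (hv f hf i)
    refine ⟨∑ i, ‖ContinuousLinearMap.smulRightL ℝ E ℂ (ℓ i)‖ * C i, fun z => ?_⟩
    rw [← norm_iteratedFDeriv_fderiv, hfd f hf, iteratedFDeriv_sum fun i _ =>
      (ContinuousLinearMap.contDiff _).comp (hc n _ (hv f hf i)), Finset.sum_apply]
    calc _ ≤ ‖z‖ ^ k * ∑ i, ‖ContinuousLinearMap.smulRightL ℝ E ℂ (ℓ i)‖ *
          ‖iteratedFDeriv ℝ n (fun z => fderiv ℝ f z (v i)) z‖ := by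
          gcongr
          refine (norm_sum_le _ _).trans (Finset.sum_le_sum fun i _ => ?_)
          exact ContinuousLinearMap.norm_iteratedFDeriv_comp_left _
            (hc n _ (hv f hf i)).contDiffAt le_rfl
      _ = ∑ i, ‖ContinuousLinearMap.smulRightL ℝ E ℂ (ℓ i)‖ *
          (‖z‖ ^ k * ‖iteratedFDeriv ℝ n (fun z => fderiv ℝ f z (v i)) z‖) := by
          rw [Finset.mul_sum]
          exact Finset.sum_congr rfl fun i _ => by ring
      _ ≤ _ := by gcongr with i; exact hC i z

end Criterion

/-! ### Phase space -/

instance instIsAddHaarMeasurePhase : (volume : Measure (Phase N)).IsAddHaarMeasure :=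
  inferInstanceAs ((volume : Measure (Config N)).prod volume).IsAddHaarMeasure

/-- The standard basis of phase space, `Sum.inl n` for `pₙ` and `Sum.inr n` for `xₙ`. -/
def basisVec (i : Fin N ⊕ Fin N) : Phase N :=
  Sum.elim (fun n => (EuclideanSpace.single n 1, 0)) (fun n => (0, EuclideanSpace.single n 1)) i

/-- The coordinate functions of phase space. -/
def coordCLM (i : Fin N ⊕ Fin N) : Phase N →L[ℝ] ℝ :=
  Sum.elim (fun n => (EuclideanSpace.proj n).comp (ContinuousLinearMap.fst ℝ _ _))
    (fun n => (EuclideanSpace.proj n).comp (ContinuousLinearMap.snd ℝ _ _)) i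

@[simp] theorem coordCLM_inl (n : Fin N) (z : Phase N) : coordCLM (Sum.inl n) z = z.1 n := rfl

@[simp] theorem coordCLM_inr (n : Fin N) (z : Phase N) : coordCLM (Sum.inr n) z = z.2 n := rfl

theorem sum_single_smul (x : Config N) :
    ∑ n, x n • (EuclideanSpace.single n 1 : Config N) = x := by
  ext m
  simp [Finset.sum_apply, Pi.single_apply]

theorem sum_coordCLM_smul (z : Phase N) : ∑ i, coordCLM i z • basisVec i = z := by
  simp [Fintype.sum_sum_type, basisVec, Prod.ext_iff, Prod.fst_sum, Prod.snd_sum,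
    sum_single_smul]

/-- The partial derivative of a function on phase space in a coordinate direction. -/
def pd (i : Fin N ⊕ Fin N) (f : Phase N → ℂ) (z : Phase N) : ℂ := fderiv ℝ f z (basisVec i)

theorem dp_eq_pd (n : Fin N) : dp n = pd (Sum.inl n) := rfl

theorem dx_eq_pd (n : Fin N) : dx n = pd (Sum.inr n) := rfl

/-- Serves for two classes: partial Fourier transforms of Schwartz functions, and polynomials times
a fixed Gaussian. -/
theorem exists_schwartzMap_phase {S : Set (Phase N → ℂ)} (hb : ∀ f ∈ S, ∃ C, ∀ z, ‖f z‖ ≤ C)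
    (hm : ∀ f ∈ S, ∀ i, (fun z => (coordCLM i z : ℂ) * f z) ∈ S)
    (hd : ∀ f ∈ S, Differentiable ℝ f) (hv : ∀ f ∈ S, ∀ i, pd i f ∈ S) {f : Phase N → ℂ}
    (hf : f ∈ S) : ∃ F : 𝓢(Phase N, ℂ), ⇑F = f :=
  exists_schwartzMap_of_class coordCLM basisVec (fun z => (sum_coordCLM_smul z).symm) hb hm hd hv hf

/-- Multiplication of a Schwartz function by a real linear function. -/
def mulCLM {E : Type*} [NormedAddCommGroup E] [NormedSpace ℝ E] (ℓ : E →L[ℝ] ℝ) (f : 𝓢(E, ℂ)) :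
    𝓢(E, ℂ) :=
  smulLeftCLM ℂ (fun x => ℓ x) f

@[simp] theorem mulCLM_apply {E : Type*} [NormedAddCommGroup E] [NormedSpace ℝ E] (ℓ : E →L[ℝ] ℝ)
    (f : 𝓢(E, ℂ)) (x : E) : mulCLM ℓ f x = ℓ x * f x := by
  rw [mulCLM, smulLeftCLM_apply_apply ℓ.hasTemperateGrowth]
  simp

/-! ### The partial Fourier transform -/

/-- The restriction of a Schwartz function to `{x} × ℝᴺ`. -/
def slice (f : 𝓢(Config N × Config N, ℂ)) (x : Config N) : 𝓢(Config N, ℂ) :=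
  compCLMOfAntilipschitz ℂ (K := 1) (g := fun ξ : Config N => (x, ξ))
    (by
      convert (Function.HasTemperateGrowth.const (x, (0 : Config N))).add
        (ContinuousLinearMap.inr ℝ (Config N) (Config N)).hasTemperateGrowth using 1
      ext <;> simp)
    (AntilipschitzWith.of_le_mul_dist fun a b => by simp [Prod.dist_eq]) f

@[simp] theorem slice_apply (f : 𝓢(Config N × Config N, ℂ)) (x ξ : Config N) :
    slice f x ξ = f (x, ξ) := rfl

/-- The partial Fourier transform `∫ f(x, ξ) exp(-i p·ξ/ħ) dξ` at `z = (p, x)`. -/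
def pft (ħ : ℝ) (f : Config N × Config N → ℂ) (z : Phase N) : ℂ :=
  ∫ ξ : Config N, f (z.2, ξ) * Complex.exp (-Complex.I * (inner ℝ z.1 ξ / ħ : ℝ))

theorem fourier_eq_integral (ħ : ℝ) (ψ : Config N → ℂ) (p : Config N) :
    𝓕 ψ ((2 * Real.pi * ħ)⁻¹ • p) =
      ∫ ξ, ψ ξ * Complex.exp (-Complex.I * (inner ℝ p ξ / ħ : ℝ)) := by
  rw [Real.fourier_eq']
  refine integral_congr_ae (Filter.Eventually.of_forall fun ξ => ?_)
  simp only [smul_eq_mul]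
  rw [mul_comm]
  congr 2
  rw [inner_smul_right, real_inner_comm]
  have : (Real.pi : ℂ) ≠ 0 := by exact_mod_cast Real.pi_ne_zero
  push_cast
  field_simp

theorem pft_eq_fourier (ħ : ℝ) (f : 𝓢(Config N × Config N, ℂ)) (z : Phase N) :
    pft ħ f z = 𝓕 (slice f z.2) ((2 * Real.pi * ħ)⁻¹ • z.1) :=
  (fourier_eq_integral ħ (slice f z.2) z.1).symm

/-- Decay of order `k + m` leaves `(1 + ‖ξ‖)⁻ᵐ`, integrable for `m` large. Uniformity in `x` makes
the bound a dominating function for integrals over `ξ` alone. -/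
theorem exists_integrable_bound {V : Type*} [NormedAddCommGroup V] [NormedSpace ℝ V]
    (f : 𝓢(Config N × Config N, V)) (k : ℕ) :
    ∃ b : Config N → ℝ, Integrable b ∧ ∀ x ξ, ‖ξ‖ ^ k * ‖f (x, ξ)‖ ≤ b ξ := by
  set m := (volume : Measure (Config N)).integrablePower
  set C := 2 ^ (k + m) *
    ((Finset.Iic (k + m, 0)).sup fun m => SchwartzMap.seminorm ℝ m.1 m.2) f
  refine ⟨fun ξ => C * (1 + ‖ξ‖) ^ (-(m : ℝ)),
    (Measure.integrable_pow_neg_integrablePower _).const_mul _, fun x ξ => ?_⟩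
  have h := one_add_le_sup_seminorm_apply (𝕜 := ℝ) (m := (k + m, 0)) le_rfl le_rfl f (x, ξ)
  rw [norm_iteratedFDeriv_zero] at h
  have hξ : (0 : ℝ) < 1 + ‖ξ‖ := by positivity
  beta_reduce
  rw [Real.rpow_neg hξ.le, Real.rpow_natCast, ← div_eq_mul_inv, le_div_iff₀ (by positivity)]
  have hle : ‖ξ‖ ≤ ‖(x, ξ)‖ := le_max_right _ _
  calc ‖ξ‖ ^ k * ‖f (x, ξ)‖ * (1 + ‖ξ‖) ^ m
      ≤ (1 + ‖(x, ξ)‖) ^ k * ‖f (x, ξ)‖ * (1 + ‖(x, ξ)‖) ^ m := by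
        gcongr
        linarith
    _ = (1 + ‖(x, ξ)‖) ^ (k + m) * ‖f (x, ξ)‖ := by ring
    _ ≤ C := h

theorem norm_exp_neg_I_mul (r : ℝ) : ‖Complex.exp (-Complex.I * (r : ℂ))‖ = 1 := by
  rw [Complex.norm_exp]
  simp

theorem exists_norm_pft_le (ħ : ℝ) (f : 𝓢(Config N × Config N, ℂ)) :
    ∃ C, ∀ z, ‖pft ħ f z‖ ≤ C := by
  obtain ⟨b, hb, hle⟩ := exists_integrable_bound f 0
  refine ⟨∫ ξ, b ξ, fun z => norm_integral_le_of_norm_le hb (.of_forall fun ξ => ?_)⟩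
  rw [norm_mul, norm_exp_neg_I_mul, mul_one]
  simpa using hle z.2 ξ

/-- The derivative in `z = (p, x)` of the integrand of `pft`. -/
def pftDeriv (ħ : ℝ) (f : 𝓢(Config N × Config N, ℂ)) (z : Phase N) (ξ : Config N) :
    Phase N →L[ℝ] ℂ :=
  Complex.exp (-Complex.I * (inner ℝ z.1 ξ / ħ : ℝ)) •
    ((fderiv ℝ f (z.2, ξ)).comp ((ContinuousLinearMap.inl ℝ (Config N) (Config N)).comp
      (ContinuousLinearMap.snd ℝ (Config N) (Config N))) +
    (f (z.2, ξ) * (-Complex.I / ħ)) • (Complex.ofRealCLM.comp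
      ((innerSL ℝ ξ).comp (ContinuousLinearMap.fst ℝ (Config N) (Config N)))))

theorem hasFDerivAt_pft_integrand (ħ : ℝ) (f : 𝓢(Config N × Config N, ℂ)) (ξ : Config N)
    (z : Phase N) : HasFDerivAt (fun z : Phase N => f (z.2, ξ) *
      Complex.exp (-Complex.I * (inner ℝ z.1 ξ / ħ : ℝ))) (pftDeriv ħ f z ξ) z := by
  have h1 : HasFDerivAt (fun z : Phase N => (z.2, ξ))
      ((ContinuousLinearMap.inl ℝ (Config N) (Config N)).comp
        (ContinuousLinearMap.snd ℝ (Config N) (Config N))) z :=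
    ((ContinuousLinearMap.snd ℝ (Config N) (Config N)).hasFDerivAt.prodMk
      (hasFDerivAt_const ξ z)).congr_fderiv (by ext <;> simp)
  have h2 := (f.hasFDerivAt (z.2, ξ)).comp z h1
  have h3 : HasFDerivAt (fun z : Phase N => -Complex.I * ((inner ℝ z.1 ξ / ħ : ℝ) : ℂ))
      ((-Complex.I / ħ) • (Complex.ofRealCLM.comp
      ((innerSL ℝ ξ).comp (ContinuousLinearMap.fst ℝ (Config N) (Config N))))) z := by
    refine (((-Complex.I / (ħ : ℂ)) • (Complex.ofRealCLM.comp
      ((innerSL ℝ ξ).comp (ContinuousLinearMap.fst ℝ (Config N) (Config N))))).hasFDerivAt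
      (x := z)).congr_of_eventuallyEq (.of_forall fun z => ?_)
    simp [real_inner_comm]
    ring
  refine (h2.mul h3.cexp).congr_fderiv ?_
  ext w <;> simp [pftDeriv]
  ring

/-- Differentiation under the integral sign: the `x`-derivative is dominated through `fderiv ℝ f`,
while the `p`-derivative brings down a factor `ξ`, whence the bound with exponent 1. -/
theorem hasFDerivAt_pft (ħ : ℝ) (f : 𝓢(Config N × Config N, ℂ)) (z : Phase N) :
    Integrable (pftDeriv ħ f z) ∧ HasFDerivAt (pft ħ f) (∫ ξ, pftDeriv ħ f z ξ) z := by
  obtain ⟨b₁, hb₁, hle₁⟩ := exists_integrable_bound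
    (fderivCLM ℝ (Config N × Config N) ℂ f) 0
  obtain ⟨b₂, hb₂, hle₂⟩ := exists_integrable_bound f 1
  obtain ⟨b₀, hb₀, hle₀⟩ := exists_integrable_bound f 0
  have hbound : ∀ z ξ, ‖pftDeriv ħ f z ξ‖ ≤ b₁ ξ + b₂ ξ * ‖(-Complex.I / ħ : ℂ)‖ := by
    intro z ξ
    rw [pftDeriv, norm_smul, norm_exp_neg_I_mul, one_mul]
    have hinl : ‖(ContinuousLinearMap.inl ℝ (Config N) (Config N)).comp
        (ContinuousLinearMap.snd ℝ (Config N) (Config N))‖ ≤ 1 :=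
      ContinuousLinearMap.opNorm_le_bound _ zero_le_one fun w => by
        simp [Prod.norm_def]
    have hfst : ‖Complex.ofRealCLM.comp ((innerSL ℝ ξ).comp
        (ContinuousLinearMap.fst ℝ (Config N) (Config N)))‖ ≤ ‖ξ‖ :=
      ContinuousLinearMap.opNorm_le_bound _ (norm_nonneg _) fun w => by
        simp only [ContinuousLinearMap.comp_apply, Complex.ofRealCLM_apply, Complex.norm_real]
        exact (norm_inner_le_norm _ _).trans
          (mul_le_mul_of_nonneg_left (norm_fst_le w) (norm_nonneg _))
    have e1 := hle₁ z.2 ξ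
    have e2 := hle₂ z.2 ξ
    simp only [pow_zero, one_mul, pow_one, fderivCLM_apply] at e1 e2
    refine (norm_add_le _ _).trans (add_le_add ?_ ?_)
    · refine (ContinuousLinearMap.opNorm_comp_le _ _).trans (le_trans ?_ e1)
      exact mul_le_of_le_one_right (norm_nonneg _) hinl
    · rw [norm_smul, norm_mul]
      calc _ ≤ ‖f (z.2, ξ)‖ * ‖(-Complex.I / ħ : ℂ)‖ * ‖ξ‖ := by gcongr
        _ = (‖ξ‖ * ‖f (z.2, ξ)‖) * ‖(-Complex.I / ħ : ℂ)‖ := by ring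
        _ ≤ _ := by gcongr
  have hcont : ∀ z : Phase N, Continuous fun ξ : Config N => f (z.2, ξ) *
      Complex.exp (-Complex.I * (inner ℝ z.1 ξ / ħ : ℝ)) := fun z => by fun_prop
  have hcont' : Continuous (pftDeriv ħ f z) := by
    have : Continuous fun ξ => fderiv ℝ f (z.2, ξ) :=
      (fderivCLM ℝ (Config N × Config N) ℂ f).continuous.comp (by fun_prop)
    have h2 : Continuous fun ξ : Config N => innerSL ℝ ξ := (innerSL ℝ).continuous
    unfold pftDeriv
    fun_prop
  have hbi := hb₁.add (hb₂.mul_const ‖(-Complex.I / ħ : ℂ)‖)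
  refine ⟨hbi.mono' hcont'.aestronglyMeasurable (.of_forall (hbound z)),
    hasFDerivAt_integral_of_dominated_of_fderiv_le (F' := pftDeriv ħ f) Filter.univ_mem
      (.of_forall fun z => (hcont z).aestronglyMeasurable) ?_ hcont'.aestronglyMeasurable
      (.of_forall fun ξ z _ => hbound z ξ) hbi
      (.of_forall fun ξ z _ => hasFDerivAt_pft_integrand ħ f ξ z)⟩
  refine hb₀.mono' (hcont z).aestronglyMeasurable (.of_forall fun ξ => ?_)
  rw [norm_mul, norm_exp_neg_I_mul, mul_one]
  simpa using hle₀ z.2 ξ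

theorem differentiable_pft (ħ : ℝ) (f : 𝓢(Config N × Config N, ℂ)) :
    Differentiable ℝ (pft ħ f) := fun z => (hasFDerivAt_pft ħ f z).2.differentiableAt

theorem pft_const_smul (ħ : ℝ) (c : ℂ) (f : 𝓢(Config N × Config N, ℂ)) (z : Phase N) :
    pft ħ (c • f) z = c * pft ħ f z := by
  simp only [pft, ← integral_const_mul]
  congr with ξ
  simp [mul_assoc]

theorem integrable_pft (ħ : ℝ) (f : 𝓢(Config N × Config N, ℂ)) (z : Phase N) :
    Integrable fun ξ : Config N => f (z.2, ξ) *
      Complex.exp (-Complex.I * (inner ℝ z.1 ξ / ħ : ℝ)) := by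
  refine (slice f z.2).integrable.mul_bdd (c := 1) (by fun_prop) (.of_forall fun ξ => ?_)
  rw [norm_exp_neg_I_mul]

theorem pft_add (ħ : ℝ) (f g : 𝓢(Config N × Config N, ℂ)) (z : Phase N) :
    pft ħ (f + g) z = pft ħ f z + pft ħ g z := by
  simp only [pft]
  rw [← integral_add (integrable_pft ħ f z) (integrable_pft ħ g z)]
  congr with ξ
  simp [add_mul]

theorem pd_inl_pft (ħ : ℝ) (f : 𝓢(Config N × Config N, ℂ)) (n : Fin N) :
    pd (Sum.inl n) (pft ħ f) = pft ħ ((-Complex.I / ħ) • mulCLM (coordCLM (Sum.inr n)) f) := by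
  ext z
  obtain ⟨hi, hd⟩ := hasFDerivAt_pft ħ f z
  rw [pd, hd.fderiv, ContinuousLinearMap.integral_apply hi]
  refine integral_congr_ae (.of_forall fun ξ => ?_)
  simp [pftDeriv, basisVec, EuclideanSpace.inner_single_right, Prod.mk_zero_zero]
  ring

theorem pd_inr_pft (ħ : ℝ) (f : 𝓢(Config N × Config N, ℂ)) (n : Fin N) :
    pd (Sum.inr n) (pft ħ f) =
      pft ħ (∂_{((EuclideanSpace.single n 1 : Config N), (0 : Config N))} f :
        𝓢(Config N × Config N, ℂ)) := by
  ext z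
  obtain ⟨hi, hd⟩ := hasFDerivAt_pft ħ f z
  rw [pd, hd.fderiv, ContinuousLinearMap.integral_apply hi]
  refine integral_congr_ae (.of_forall fun ξ => ?_)
  simp [pftDeriv, basisVec, lineDerivOp_apply_eq_fderiv]
  ring

theorem slice_lineDerivOp (f : 𝓢(Config N × Config N, ℂ)) (x v : Config N) :
    slice (∂_{((0 : Config N), v)} f) x = ∂_{v} (slice f x) := by
  ext ξ
  rw [slice_apply, lineDerivOp_apply_eq_fderiv, lineDerivOp_apply_eq_fderiv]
  have h : HasFDerivAt (fun ξ : Config N => (x, ξ))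
      (ContinuousLinearMap.inr ℝ (Config N) (Config N)) ξ := hasFDerivAt_prodMk_right x ξ
  have := ((f.hasFDerivAt (x, ξ)).comp ξ h).fderiv
  rw [show ⇑(slice f x) = f ∘ fun ξ => (x, ξ) from rfl, this]
  simp

/-- A derivative in `ξ` becomes multiplication by `p` under the Fourier transform. Together with
`coord_inr_mul_pft`, `pd_inl_pft` and `pd_inr_pft` this gives the closure properties required by the
Schwartz criterion. -/
theorem coord_inl_mul_pft {ħ : ℝ} (hħ : ħ ≠ 0) (f : 𝓢(Config N × Config N, ℂ)) (n : Fin N)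
    (z : Phase N) : (z.1 n : ℂ) * pft ħ f z =
      pft ħ ((-Complex.I * ħ) •
        ∂_{((0 : Config N), (EuclideanSpace.single n 1 : Config N))} f) z := by
  rw [pft_const_smul, pft_eq_fourier, pft_eq_fourier, slice_lineDerivOp, fourier_lineDerivOp_eq,
    smul_apply, smulLeftCLM_apply_apply (by fun_prop)]
  have : (Real.pi : ℂ) ≠ 0 := by exact_mod_cast Real.pi_ne_zero
  have : (ħ : ℂ) ≠ 0 := by exact_mod_cast hħ
  simp [EuclideanSpace.inner_single_right]
  field_simp
  simp

theorem coord_inr_mul_pft (ħ : ℝ) (f : 𝓢(Config N × Config N, ℂ)) (n : Fin N)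
    (z : Phase N) : (z.2 n : ℂ) * pft ħ f z = pft ħ (mulCLM (coordCLM (Sum.inl n)) f) z := by
  simp only [pft, ← integral_const_mul]
  congr with ξ
  simp [mul_assoc]

/-- The partial Fourier transform preserves the Schwartz space. -/
theorem exists_schwartzMap_pft {ħ : ℝ} (hħ : ħ ≠ 0) (f : 𝓢(Config N × Config N, ℂ)) :
    ∃ F : 𝓢(Phase N, ℂ), ⇑F = pft ħ f := by
  refine exists_schwartzMap_phase
    (S := Set.range fun f : 𝓢(Config N × Config N, ℂ) => pft ħ f) ?_ ?_ ?_ ?_ ⟨f, rfl⟩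
  · rintro _ ⟨f, rfl⟩
    exact exists_norm_pft_le ħ f
  · rintro _ ⟨f, rfl⟩ (n | n)
    · exact ⟨_, funext fun z => (coord_inl_mul_pft hħ f n z).symm⟩
    · exact ⟨_, funext fun z => (coord_inr_mul_pft ħ f n z).symm⟩
  · rintro _ ⟨f, rfl⟩
    exact differentiable_pft ħ f
  · rintro _ ⟨f, rfl⟩ (n | n)
    · exact ⟨_, (pd_inl_pft ħ f n).symm⟩
    · exact ⟨_, (pd_inr_pft ħ f n).symm⟩

/-! ### Partial derivatives of smooth functions -/

section SmoothCalculus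

variable {f g : Phase N → ℂ} {i j : Fin N ⊕ Fin N}

theorem contDiff_pd (hf : ContDiff ℝ ∞ f) : ContDiff ℝ ∞ (pd i f) :=
  (hf.fderiv_right (m := ∞) (by simp)).clm_apply contDiff_const

theorem pd_add (hf : ContDiff ℝ ∞ f) (hg : ContDiff ℝ ∞ g) :
    pd i (fun z => f z + g z) = fun z => pd i f z + pd i g z := by
  ext z
  simp only [pd]
  rw [fderiv_fun_add (hf.differentiable (by simp) z) (hg.differentiable (by simp) z)]
  simp

theorem pd_sum {κ : Type*} {s : Finset κ} {F : κ → Phase N → ℂ}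
    (hF : ∀ k ∈ s, ContDiff ℝ ∞ (F k)) :
    pd i (fun z => ∑ k ∈ s, F k z) = fun z => ∑ k ∈ s, pd i (F k) z := by
  ext z
  simp only [pd]
  rw [fderiv_fun_sum fun k hk => (hF k hk).differentiable (by simp) z]
  simp

theorem pd_const_mul (c : ℂ) (hf : ContDiff ℝ ∞ f) :
    pd i (fun z => c * f z) = fun z => c * pd i f z := by
  ext z
  simp only [pd]
  rw [fderiv_const_mul (hf.differentiable (by simp) z)]
  simp

theorem pd_mul (hf : ContDiff ℝ ∞ f) (hg : ContDiff ℝ ∞ g) :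
    pd i (fun z => f z * g z) = fun z => pd i f z * g z + f z * pd i g z := by
  ext z
  simp only [pd]
  rw [fderiv_fun_mul (hf.differentiable (by simp) z) (hg.differentiable (by simp) z)]
  simp
  ring

theorem pd_conj (f : Phase N → ℂ) : pd i (fun z => conj (f z)) = fun z => conj (pd i f z) := by
  ext z
  simp only [pd]
  have := Complex.conjCLE.comp_fderiv (f := f) (x := z)
  rw [show (fun z => conj (f z)) = Complex.conjCLE ∘ f from rfl, this]
  simp

theorem pd_comm (hf : ContDiff ℝ ∞ f) : pd i (pd j f) = pd j (pd i f) := by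
  ext z
  have hd : DifferentiableAt ℝ (fderiv ℝ f) z :=
    (hf.fderiv_right (m := ∞) (by simp)).differentiable (by simp) z
  have h : ∀ v w : Phase N, fderiv ℝ (fun z => fderiv ℝ f z v) z w =
      fderiv ℝ (fderiv ℝ f) z w v := fun v w => by
    rw [fderiv_clm_apply hd (differentiableAt_const v)]
    simp
  change fderiv ℝ (fun z => fderiv ℝ f z _) z _ = fderiv ℝ (fun z => fderiv ℝ f z _) z _
  rw [h, h]
  exact (hf.contDiffAt.isSymmSndFDerivAt (by
    rw [minSmoothness_of_isRCLikeNormedField]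
    exact WithTop.coe_le_coe.2 (le_top : (2 : ℕ∞) ≤ ⊤))).eq _ _

/-- The coordinate functions as complex-valued functions. -/
def coord (i : Fin N ⊕ Fin N) (z : Phase N) : ℂ := coordCLM i z

theorem contDiff_coord : ContDiff ℝ ∞ (coord i : Phase N → ℂ) :=
  (Complex.ofRealCLM.comp (coordCLM i)).contDiff

theorem pd_coord : pd i (coord j : Phase N → ℂ) = fun _ => if i = j then 1 else 0 := by
  ext z
  rw [pd, show (coord j : Phase N → ℂ) = Complex.ofRealCLM.comp (coordCLM j) from rfl,
    ContinuousLinearMap.fderiv]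
  rcases i with n | n <;> rcases j with m | m <;>
    simp [basisVec, eq_comm, apply_ite Complex.ofReal]

end SmoothCalculus

/-! ### Powers of the Poisson bidifferential operator -/

section Poisson

variable {f g : Phase N → ℂ}

/-- The sign in the symplectic form: `-1` for momenta and `1` for positions. -/
def sgn (i : Fin N ⊕ Fin N) : ℂ := Sum.elim (fun _ => -1) (fun _ => 1) i

@[simp] theorem sgn_inl (n : Fin N) : sgn (Sum.inl n) = -1 := rfl

@[simp] theorem sgn_inr (n : Fin N) : sgn (Sum.inr n) = 1 := rfl

theorem sgn_swap (i : Fin N ⊕ Fin N) : sgn i.swap = -sgn i := by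
  rcases i with n | n <;> simp

/-- With the sign `sgn` and the exchange `Sum.swap` of conjugate variables, both halves of `Λ`
become one sum, so positions and momenta need no separate treatment. -/
theorem poissonPow_succ (l : ℕ) (f g : Phase N → ℂ) (z : Phase N) :
    poissonPow (l + 1) f g z = ∑ i, sgn i * poissonPow l (pd i f) (pd i.swap g) z := by
  rw [Fintype.sum_sum_type]
  simp only [poissonPow, Finset.sum_sub_distrib, sgn_inl, sgn_inr, Sum.swap_inl, Sum.swap_inr,
    dp_eq_pd, dx_eq_pd, neg_one_mul, one_mul, Finset.sum_neg_distrib]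
  ring

theorem poissonPow_succ' (l : ℕ) (f g : Phase N → ℂ) :
    poissonPow (l + 1) f g =
      fun z => ∑ i, sgn i * poissonPow l (pd i f) (pd i.swap g) z :=
  funext fun z => poissonPow_succ l f g z

theorem sum_swap {A : Type*} [AddCommMonoid A] (F : Fin N ⊕ Fin N → A) :
    ∑ i, F (Sum.swap i) = ∑ i, F i :=
  (Equiv.sumComm (Fin N) (Fin N)).sum_comp F

/-- `Λ` is antisymmetric: exchanging conjugate variables in the sum flips each sign. -/
theorem poissonPow_comm (l : ℕ) (f g : Phase N → ℂ) (z : Phase N) :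
    poissonPow l f g z = (-1) ^ l * poissonPow l g f z := by
  induction l generalizing f g with
  | zero => simp [poissonPow, mul_comm]
  | succ l ih =>
    rw [poissonPow_succ, poissonPow_succ, ← sum_swap, Finset.mul_sum]
    refine Finset.sum_congr rfl fun i _ => ?_
    rw [ih, sgn_swap, Sum.swap_swap]
    ring

theorem contDiff_poissonPow (l : ℕ) (hf : ContDiff ℝ ∞ f) (hg : ContDiff ℝ ∞ g) :
    ContDiff ℝ ∞ (poissonPow l f g) := by
  induction l generalizing f g with
  | zero => exact hf.mul hg
  | succ l ih =>
    rw [poissonPow_succ']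
    exact ContDiff.sum fun i _ => contDiff_const.mul (ih (contDiff_pd hf) (contDiff_pd hg))

theorem poissonPow_add_left (l : ℕ) {f₁ f₂ : Phase N → ℂ} (h₁ : ContDiff ℝ ∞ f₁)
    (h₂ : ContDiff ℝ ∞ f₂) (g : Phase N → ℂ) (z : Phase N) :
    poissonPow l (fun z => f₁ z + f₂ z) g z = poissonPow l f₁ g z + poissonPow l f₂ g z := by
  induction l generalizing f₁ f₂ g with
  | zero => simp [poissonPow, add_mul]
  | succ l ih =>
    simp only [poissonPow_succ, pd_add h₁ h₂, ih (contDiff_pd h₁) (contDiff_pd h₂), mul_add,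
      Finset.sum_add_distrib]

theorem poissonPow_const_mul_left (l : ℕ) (c : ℂ) (hf : ContDiff ℝ ∞ f) (g : Phase N → ℂ)
    (z : Phase N) : poissonPow l (fun z => c * f z) g z = c * poissonPow l f g z := by
  induction l generalizing f g with
  | zero => simp [poissonPow, mul_assoc]
  | succ l ih =>
    simp only [poissonPow_succ, pd_const_mul c hf, ih (contDiff_pd hf), Finset.mul_sum]
    exact Finset.sum_congr rfl fun i _ => by ring

theorem poissonPow_add_right (l : ℕ) {g₁ g₂ : Phase N → ℂ} (h₁ : ContDiff ℝ ∞ g₁)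
    (h₂ : ContDiff ℝ ∞ g₂) (f : Phase N → ℂ) (z : Phase N) :
    poissonPow l f (fun z => g₁ z + g₂ z) z = poissonPow l f g₁ z + poissonPow l f g₂ z := by
  rw [poissonPow_comm, poissonPow_add_left l h₁ h₂, mul_add, ← poissonPow_comm, ← poissonPow_comm]

theorem poissonPow_const_mul_right (l : ℕ) (c : ℂ) (hg : ContDiff ℝ ∞ g) (f : Phase N → ℂ)
    (z : Phase N) : poissonPow l f (fun z => c * g z) z = c * poissonPow l f g z := by
  rw [poissonPow_comm, poissonPow_const_mul_left l c hg, poissonPow_comm l f g]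
  ring

theorem poissonPow_zero_left (l : ℕ) (g : Phase N → ℂ) (z : Phase N) :
    poissonPow l (fun _ => 0) g z = 0 := by
  simpa using poissonPow_const_mul_left l 0 (f := fun _ => 0) contDiff_const g z

theorem conj_poissonPow (l : ℕ) (f g : Phase N → ℂ) (z : Phase N) :
    conj (poissonPow l f g z) = poissonPow l (fun z => conj (f z)) (fun z => conj (g z)) z := by
  induction l generalizing f g with
  | zero => simp [poissonPow]
  | succ l ih =>
    simp only [poissonPow_succ, map_sum, map_mul, ih, pd_conj]
    refine Finset.sum_congr rfl fun i _ => ?_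
    rcases i with n | n <;> simp

/-- The Leibniz rule survives because `Λ` has constant coefficients and partial derivatives commute.
-/
theorem pd_poissonPow (l : ℕ) (hf : ContDiff ℝ ∞ f) (hg : ContDiff ℝ ∞ g) (i : Fin N ⊕ Fin N)
    (z : Phase N) :
    pd i (poissonPow l f g) z = poissonPow l (pd i f) g z + poissonPow l f (pd i g) z := by
  induction l generalizing f g with
  | zero => exact congrFun (pd_mul hf hg) z
  | succ l ih =>
    have hP : ∀ j : Fin N ⊕ Fin N, ContDiff ℝ ∞ (poissonPow l (pd j f) (pd j.swap g)) := fun j =>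
      contDiff_poissonPow l (contDiff_pd hf) (contDiff_pd hg)
    rw [poissonPow_succ', pd_sum fun j _ => contDiff_const.mul (hP j), poissonPow_succ,
      poissonPow_succ, ← Finset.sum_add_distrib]
    refine Finset.sum_congr rfl fun j _ => ?_
    rw [pd_const_mul _ (hP j)]
    beta_reduce
    rw [ih (contDiff_pd hf) (contDiff_pd hg), pd_comm hf, pd_comm hg, mul_add]

/-- Second derivatives of a coordinate vanish, so at most one of the `l` factors `Λ` can act on it,
and there are `l` choices. The truncated `l - 1` is harmless, since its coefficient is zero at `l =
0`. -/
theorem poissonPow_coord_mul_left (l : ℕ) (j : Fin N ⊕ Fin N) (hf : ContDiff ℝ ∞ f)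
    (hg : ContDiff ℝ ∞ g) (z : Phase N) :
    poissonPow l (fun z => coord j z * f z) g z =
      coord j z * poissonPow l f g z + l * sgn j * poissonPow (l - 1) f (pd j.swap g) z := by
  induction l generalizing f g with
  | zero => simp [poissonPow, mul_assoc]
  | succ l ih =>
    have hpd : ∀ i, pd i (fun z => coord j z * f z) = fun z =>
        (if i = j then 1 else 0) * f z + coord j z * pd i f z := fun i => by
      rw [pd_mul contDiff_coord hf, pd_coord]
    have hstep : ∀ i : Fin N ⊕ Fin N,
        poissonPow l (pd i (fun z => coord j z * f z)) (pd i.swap g) z =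
        (if i = j then 1 else 0) * poissonPow l f (pd i.swap g) z +
          (coord j z * poissonPow l (pd i f) (pd i.swap g) z +
            l * sgn j * poissonPow (l - 1) (pd i f) (pd i.swap (pd j.swap g)) z) := fun i => by
      rw [hpd, poissonPow_add_left l (contDiff_const.mul hf)
        (contDiff_coord.mul (contDiff_pd hf)), poissonPow_const_mul_left l _ hf,
        ih (contDiff_pd hf) (contDiff_pd hg), pd_comm hg]
    have hlast : ∑ i : Fin N ⊕ Fin N, sgn i *
        (l * sgn j * poissonPow (l - 1) (pd i f) (pd i.swap (pd j.swap g)) z) =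
        l * sgn j * poissonPow l f (pd j.swap g) z := by
      cases l with
      | zero => simp
      | succ l =>
        rw [poissonPow_succ, Finset.mul_sum]
        exact Finset.sum_congr rfl fun i _ => by simp only [Nat.add_sub_cancel]; ring
    rw [poissonPow_succ, poissonPow_succ]
    simp only [hstep, mul_add, Finset.sum_add_distrib, hlast]
    simp only [ite_mul, one_mul, zero_mul, mul_ite, mul_zero, Finset.sum_ite_eq',
      Finset.mem_univ, if_true, Nat.add_sub_cancel, Finset.mul_sum]
    have : ∀ i : Fin N ⊕ Fin N, sgn i * (coord j z * poissonPow l (pd i f) (pd i.swap g) z) =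
      coord j z * (sgn i * poissonPow l (pd i f) (pd i.swap g) z) := fun i => by ring
    simp only [this]
    push_cast
    ring

theorem poissonPow_coord_mul_right (l : ℕ) (j : Fin N ⊕ Fin N) (hf : ContDiff ℝ ∞ f)
    (hg : ContDiff ℝ ∞ g) (z : Phase N) :
    poissonPow l f (fun z => coord j z * g z) z =
      coord j z * poissonPow l f g z - l * sgn j * poissonPow (l - 1) (pd j.swap f) g z := by
  rw [poissonPow_comm, poissonPow_coord_mul_left l j hg hf, poissonPow_comm l f g,
    poissonPow_comm (l - 1) (pd j.swap f) g]
  cases l with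
  | zero => simp
  | succ l =>
    simp only [Nat.add_sub_cancel]
    ring

end Poisson

/-! ### Polynomial symbols -/

section Polynomial

variable {f : Phase N → ℂ} (a b : MvPolynomial (Fin N ⊕ Fin N) ℂ)

theorem polySymbol_C (c : ℂ) :
    (polySymbol (MvPolynomial.C c) : Phase N → ℂ) = fun _ => c := by
  ext z
  simp [polySymbol]

theorem polySymbol_one : (polySymbol (1 : MvPolynomial (Fin N ⊕ Fin N) ℂ)) = fun _ => 1 := by
  ext z
  simp [polySymbol]

theorem polySymbol_X (i : Fin N ⊕ Fin N) :
    polySymbol (MvPolynomial.X i : MvPolynomial (Fin N ⊕ Fin N) ℂ) = coord i := by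
  ext z
  rcases i with n | n <;> simp [polySymbol, coord]

theorem polySymbol_add : polySymbol (a + b) = fun z => polySymbol a z + polySymbol b z := by
  ext z
  simp [polySymbol]

theorem polySymbol_mul : polySymbol (a * b) = fun z => polySymbol a z * polySymbol b z := by
  ext z
  simp [polySymbol]

theorem polySymbol_X_mul (i : Fin N ⊕ Fin N) :
    polySymbol (MvPolynomial.X i * a) = fun z => coord i z * polySymbol a z := by
  rw [polySymbol_mul, polySymbol_X]

theorem polySymbol_C_mul (c : ℂ) :
    polySymbol (MvPolynomial.C c * a) = fun z => c * polySymbol a z := by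
  rw [polySymbol_mul, polySymbol_C]

theorem polySymbol_map_algebraMap (H : MvPolynomial (Fin N ⊕ Fin N) ℝ) :
    polySymbol (MvPolynomial.map (algebraMap ℝ ℂ) H) = polySymbol H := by
  ext z
  simp [polySymbol, MvPolynomial.aeval_map_algebraMap]

theorem symbolAdjoint_polySymbol :
    symbolAdjoint (polySymbol a) = polySymbol (MvPolynomial.map (starRingEnd ℂ) a) := by
  ext z
  induction a using MvPolynomial.induction_on with
  | C c => simp [symbolAdjoint, polySymbol]
  | add p q hp hq =>
    rw [map_add, polySymbol_add, polySymbol_add]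
    simp_all [symbolAdjoint]
  | mul_X p i hp =>
    rw [map_mul, polySymbol_mul, polySymbol_mul, MvPolynomial.map_X, polySymbol_X]
    simp_all [symbolAdjoint, coord]

theorem contDiff_polySymbol : ContDiff ℝ ∞ (polySymbol a) := by
  induction a using MvPolynomial.induction_on with
  | C c => rw [polySymbol_C]; exact contDiff_const
  | add p q hp hq => rw [polySymbol_add]; exact hp.add hq
  | mul_X p i hp => rw [polySymbol_mul, polySymbol_X]; exact hp.mul contDiff_coord

theorem pd_polySymbol (i : Fin N ⊕ Fin N) :
    pd i (polySymbol a) = polySymbol (MvPolynomial.pderiv i a) := by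
  induction a using MvPolynomial.induction_on with
  | C c =>
    rw [MvPolynomial.pderiv_C, polySymbol_C, ← map_zero MvPolynomial.C, polySymbol_C]
    ext z
    simp [pd]
  | add p q hp hq =>
    rw [map_add, polySymbol_add, polySymbol_add,
      pd_add (contDiff_polySymbol p) (contDiff_polySymbol q), hp, hq]
  | mul_X p j hp =>
    rw [MvPolynomial.pderiv_mul, polySymbol_mul, polySymbol_X, polySymbol_add, polySymbol_mul,
      polySymbol_mul, pd_mul (contDiff_polySymbol p) contDiff_coord, pd_coord, polySymbol_X, hp,
      MvPolynomial.pderiv_X]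
    ext z
    by_cases h : i = j
    · subst h; simp [polySymbol]
    · simp [polySymbol, h, Ne.symm h]

/-- `Λˡ` differentiates the polynomial `l` times. That `M` does not depend on `f` lets several Moyal
series with the same symbol be cut off at a common length. -/
theorem exists_poissonPow_polySymbol_eq_zero :
    ∃ M, ∀ l ≥ M, ∀ f : Phase N → ℂ, ContDiff ℝ ∞ f → ∀ z,
      poissonPow l f (polySymbol a) z = 0 := by
  induction a using MvPolynomial.induction_on with
  | C c =>
    refine ⟨1, fun l hl f _ z => ?_⟩
    obtain ⟨l, rfl⟩ := Nat.exists_eq_add_of_le' hl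
    rw [poissonPow_succ]
    refine Finset.sum_eq_zero fun i _ => ?_
    have : pd i.swap (polySymbol (MvPolynomial.C c)) = fun _ : Phase N => 0 := by
      rw [polySymbol_C]
      ext z
      simp [pd]
    rw [this, poissonPow_comm, poissonPow_zero_left]
    simp
  | add p q hp hq =>
    obtain ⟨M, hM⟩ := hp
    obtain ⟨K, hK⟩ := hq
    refine ⟨max M K, fun l hl f hf z => ?_⟩
    rw [polySymbol_add, poissonPow_add_right l (contDiff_polySymbol p) (contDiff_polySymbol q),
      hM l (le_of_max_le_left hl) f hf, hK l (le_of_max_le_right hl) f hf, add_zero]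
  | mul_X p j hp =>
    obtain ⟨M, hM⟩ := hp
    refine ⟨M + 1, fun l hl f hf z => ?_⟩
    rw [mul_comm, polySymbol_X_mul, poissonPow_coord_mul_right l j hf (contDiff_polySymbol p),
      hM l (by omega) f hf, hM (l - 1) (by omega) _ (contDiff_pd hf)]
    simp

end Polynomial

/-! ### Moyal and sinc products with polynomials -/

section Moyal

variable {f g : Phase N → ℂ} {ħ : ℝ}

theorem moyal_eq_sum {M : ℕ} {z : Phase N} (h : ∀ l ≥ M, poissonPow l f g z = 0) :
    moyal ħ f g z = ∑ l ∈ Finset.range M,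
      (Complex.I * ħ / 2) ^ l / (l.factorial : ℂ) * poissonPow l f g z :=
  tsum_eq_sum fun l hl => by rw [h l (by simpa using hl), mul_zero]

theorem sincProd_eq_sum {M : ℕ} {z : Phase N} (h : ∀ l ≥ M, poissonPow l f g z = 0) :
    sincProd ħ f g z = ∑ j ∈ Finset.range M, (-1 : ℂ) ^ j * (ħ / 2 : ℂ) ^ (2 * j) /
      ((2 * j + 1).factorial : ℂ) * poissonPow (2 * j) f g z :=
  tsum_eq_sum fun j hj => by
    have : M ≤ j := by simpa using hj
    rw [h (2 * j) (by omega), mul_zero]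

theorem exists_poissonPow_polySymbol_left_eq_zero (a : MvPolynomial (Fin N ⊕ Fin N) ℂ) :
    ∃ M, ∀ l ≥ M, ∀ f : Phase N → ℂ, ContDiff ℝ ∞ f → ∀ z,
      poissonPow l (polySymbol a) f z = 0 := by
  obtain ⟨M, hM⟩ := exists_poissonPow_polySymbol_eq_zero a
  exact ⟨M, fun l hl f hf z => by rw [poissonPow_comm, hM l hl f hf, mul_zero]⟩

variable (a b : MvPolynomial (Fin N ⊕ Fin N) ℂ)

theorem moyal_one (f : Phase N → ℂ) :
    moyal ħ (polySymbol (1 : MvPolynomial (Fin N ⊕ Fin N) ℂ)) f = f := by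
  ext z
  rw [moyal_eq_sum (M := 1)]
  · simp [poissonPow, polySymbol_one]
  · intro l hl
    obtain ⟨l, rfl⟩ := Nat.exists_eq_add_of_le' hl
    rw [poissonPow_succ]
    refine Finset.sum_eq_zero fun i _ => ?_
    have : pd i (polySymbol (1 : MvPolynomial (Fin N ⊕ Fin N) ℂ)) = fun _ : Phase N => 0 := by
      rw [polySymbol_one]
      ext z
      simp [pd]
    rw [this, poissonPow_zero_left, mul_zero]

theorem moyal_add_left (hf : ContDiff ℝ ∞ f) (z : Phase N) :
    moyal ħ (polySymbol (a + b)) f z =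
      moyal ħ (polySymbol a) f z + moyal ħ (polySymbol b) f z := by
  obtain ⟨M, hM⟩ := exists_poissonPow_polySymbol_left_eq_zero a
  obtain ⟨K, hK⟩ := exists_poissonPow_polySymbol_left_eq_zero b
  have hadd : ∀ l, poissonPow l (polySymbol (a + b)) f z =
      poissonPow l (polySymbol a) f z + poissonPow l (polySymbol b) f z := fun l => by
    rw [polySymbol_add, poissonPow_add_left l (contDiff_polySymbol a) (contDiff_polySymbol b)]
  rw [moyal_eq_sum (M := max M K) fun l hl => hM l (le_of_max_le_left hl) f hf z,
    moyal_eq_sum (M := max M K) fun l hl => hK l (le_of_max_le_right hl) f hf z,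
    moyal_eq_sum (M := max M K) fun l hl => by
      rw [hadd, hM l (le_of_max_le_left hl) f hf z, hK l (le_of_max_le_right hl) f hf z, add_zero],
    ← Finset.sum_add_distrib]
  exact Finset.sum_congr rfl fun l _ => by rw [hadd, mul_add]

theorem moyal_C_mul_left (c : ℂ) (f : Phase N → ℂ) (z : Phase N) :
    moyal ħ (polySymbol (MvPolynomial.C c * a)) f z = c * moyal ħ (polySymbol a) f z := by
  rw [moyal, moyal, ← tsum_mul_left]
  refine tsum_congr fun l => ?_
  rw [polySymbol_C_mul, poissonPow_const_mul_left l c (contDiff_polySymbol a)]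
  ring

theorem moyal_add_right {g : Phase N → ℂ} (hf : ContDiff ℝ ∞ f) (hg : ContDiff ℝ ∞ g)
    (z : Phase N) : moyal ħ (polySymbol a) (fun z => f z + g z) z =
      moyal ħ (polySymbol a) f z + moyal ħ (polySymbol a) g z := by
  obtain ⟨M, hM⟩ := exists_poissonPow_polySymbol_left_eq_zero a
  rw [moyal_eq_sum fun l hl => hM l hl f hf z, moyal_eq_sum fun l hl => hM l hl g hg z,
    moyal_eq_sum fun l hl => hM l hl _ (hf.add hg) z, ← Finset.sum_add_distrib]
  exact Finset.sum_congr rfl fun l _ => by rw [poissonPow_add_right l hf hg, mul_add]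

theorem moyal_const_mul_right (c : ℂ) (hf : ContDiff ℝ ∞ f) (z : Phase N) :
    moyal ħ (polySymbol a) (fun z => c * f z) z = c * moyal ħ (polySymbol a) f z := by
  rw [moyal, moyal, ← tsum_mul_left]
  refine tsum_congr fun l => ?_
  rw [poissonPow_const_mul_right l c hf]
  ring

/-- Left Moyal multiplication by a coordinate, `f ↦ cⱼ f ± (iħ/2) ∂f/∂cⱼ'` for the conjugate
variable `cⱼ'`. -/
def bopp (ħ : ℝ) (j : Fin N ⊕ Fin N) (f : Phase N → ℂ) (z : Phase N) : ℂ :=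
  coord j z * f z + Complex.I * ħ / 2 * sgn j * pd j.swap f z

/-- The factor `l` cancels against `l!` and shifts the index: this is the derivative of the
exponential series, in truncated form. It turns the coordinate rules for `Λˡ` into those for `⋆`. -/
theorem sum_range_succ_shift (M : ℕ) (c s : ℂ) (P Q : ℕ → ℂ) (x : ℂ) (hM : P M = 0) :
    ∑ l ∈ Finset.range (M + 1), c ^ l / (l.factorial : ℂ) * (x * P l + l * s * Q (l - 1)) =
      x * ∑ l ∈ Finset.range M, c ^ l / (l.factorial : ℂ) * P l +
        c * s * ∑ l ∈ Finset.range M, c ^ l / (l.factorial : ℂ) * Q l := by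
  simp only [mul_add, Finset.sum_add_distrib]
  congr 1
  · rw [Finset.sum_range_succ, hM, Finset.mul_sum]
    simp only [mul_zero, add_zero]
    exact Finset.sum_congr rfl fun l _ => by ring
  · rw [Finset.sum_range_succ', Finset.mul_sum]
    simp only [Nat.cast_zero, zero_mul, mul_zero, add_zero, Nat.add_sub_cancel]
    refine Finset.sum_congr rfl fun l _ => ?_
    rw [Nat.factorial_succ]
    have h1 : (l.factorial : ℂ) ≠ 0 := by exact_mod_cast l.factorial_ne_zero
    have h2 : ((l : ℂ) + 1) ≠ 0 := by exact_mod_cast l.succ_ne_zero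
    push_cast
    field_simp
    ring

theorem moyal_coord_mul_left (j : Fin N ⊕ Fin N) (hf : ContDiff ℝ ∞ f) (z : Phase N) :
    moyal ħ (polySymbol (MvPolynomial.X j * a)) f z = coord j z * moyal ħ (polySymbol a) f z +
      Complex.I * ħ / 2 * sgn j * moyal ħ (polySymbol a) (pd j.swap f) z := by
  obtain ⟨M, hM⟩ := exists_poissonPow_polySymbol_left_eq_zero a
  have hP : ∀ l, poissonPow l (polySymbol (MvPolynomial.X j * a)) f z =
      coord j z * poissonPow l (polySymbol a) f z +
        l * sgn j * poissonPow (l - 1) (polySymbol a) (pd j.swap f) z := fun l => by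
    rw [polySymbol_X_mul, poissonPow_coord_mul_left l j (contDiff_polySymbol a) hf]
  rw [moyal_eq_sum fun l hl => hM l hl f hf z,
    moyal_eq_sum fun l hl => hM l hl _ (contDiff_pd hf) z,
    moyal_eq_sum (M := M + 1) fun l hl => by
      rw [hP, hM l (by omega) f hf, hM (l - 1) (by omega) _ (contDiff_pd hf)]; simp]
  simp only [hP]
  exact sum_range_succ_shift M _ _ _ (fun l => poissonPow l (polySymbol a) (pd j.swap f) z) _
    (hM M le_rfl f hf z)

theorem moyal_coord_mul_right (j : Fin N ⊕ Fin N) (hf : ContDiff ℝ ∞ f) (z : Phase N) :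
    moyal ħ (polySymbol a) (fun z => coord j z * f z) z = coord j z * moyal ħ (polySymbol a) f z -
      Complex.I * ħ / 2 * sgn j * moyal ħ (pd j.swap (polySymbol a)) f z := by
  obtain ⟨M, hM⟩ := exists_poissonPow_polySymbol_left_eq_zero a
  obtain ⟨K, hK⟩ :=
    exists_poissonPow_polySymbol_left_eq_zero (MvPolynomial.pderiv j.swap a)
  rw [pd_polySymbol]
  have hP : ∀ l, poissonPow l (polySymbol a) (fun z => coord j z * f z) z =
      coord j z * poissonPow l (polySymbol a) f z + l * (-sgn j) *
        poissonPow (l - 1) (polySymbol (MvPolynomial.pderiv j.swap a)) f z := fun l => by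
    rw [poissonPow_coord_mul_right l j (contDiff_polySymbol a) hf, pd_polySymbol]
    ring
  rw [moyal_eq_sum (M := max M K) fun l hl => hM l (le_of_max_le_left hl) f hf z,
    moyal_eq_sum (M := max M K) fun l hl => hK l (le_of_max_le_right hl) f hf z,
    moyal_eq_sum (M := max M K + 1) fun l hl => by
      rw [hM l (by omega) _ (contDiff_coord.mul hf)]]
  simp only [hP]
  rw [sum_range_succ_shift (max M K) _ _ _
    (fun l => poissonPow l (polySymbol (MvPolynomial.pderiv j.swap a)) f z) _
    (hM _ (le_max_left _ _) f hf z)]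
  ring

theorem moyal_pd_right (i : Fin N ⊕ Fin N) (hf : ContDiff ℝ ∞ f) (z : Phase N) :
    pd i (moyal ħ (polySymbol a) f) z =
      moyal ħ (pd i (polySymbol a)) f z + moyal ħ (polySymbol a) (pd i f) z := by
  obtain ⟨M, hM⟩ := exists_poissonPow_polySymbol_left_eq_zero a
  obtain ⟨K, hK⟩ := exists_poissonPow_polySymbol_left_eq_zero (MvPolynomial.pderiv i a)
  have h : moyal ħ (polySymbol a) f = fun z => ∑ l ∈ Finset.range (max M K),
      (Complex.I * ħ / 2) ^ l / (l.factorial : ℂ) * poissonPow l (polySymbol a) f z :=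
    funext fun z => moyal_eq_sum fun l hl => hM l (le_of_max_le_left hl) f hf z
  have hc : ∀ l, ContDiff ℝ ∞ (poissonPow l (polySymbol a) f) := fun l =>
    contDiff_poissonPow l (contDiff_polySymbol a) hf
  rw [h, pd_sum fun l _ => contDiff_const.mul (hc l), pd_polySymbol,
    moyal_eq_sum (M := max M K) fun l hl => hK l (le_of_max_le_right hl) f hf z,
    moyal_eq_sum (M := max M K) fun l hl => hM l (le_of_max_le_left hl) _ (contDiff_pd hf) z,
    ← Finset.sum_add_distrib]
  refine Finset.sum_congr rfl fun l _ => ?_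
  rw [pd_const_mul _ (hc l), ← pd_polySymbol]
  beta_reduce
  rw [pd_poissonPow l (contDiff_polySymbol a) hf, mul_add]

/-- A symbol `cⱼ a` acts as the symmetrized product of the actions of `cⱼ` and `a`. -/
theorem moyal_coord_mul_eq_half (j : Fin N ⊕ Fin N) (hf : ContDiff ℝ ∞ f) (z : Phase N) :
    moyal ħ (polySymbol (MvPolynomial.X j * a)) f z = 1 / 2 *
      (bopp ħ j (moyal ħ (polySymbol a) f) z + moyal ħ (polySymbol a) (bopp ħ j f) z) := by
  have h : moyal ħ (polySymbol a) (bopp ħ j f) z =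
      moyal ħ (polySymbol a) (fun z => coord j z * f z) z +
        Complex.I * ħ / 2 * sgn j * moyal ħ (polySymbol a) (pd j.swap f) z := by
    rw [← moyal_const_mul_right a _ (contDiff_pd hf), ← moyal_add_right a
      (contDiff_coord.mul hf) (contDiff_const.mul (contDiff_pd hf))]
    rfl
  -- The terms in which `a` is differentiated enter the two orderings with opposite signs and cancel
  -- in the mean.
  rw [h, moyal_coord_mul_left a j hf, moyal_coord_mul_right a j hf, bopp, moyal_pd_right a _ hf]
  ring

/-- The coordinate commutes with a symbol free of the conjugate variable, so no symmetrization is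
needed. The case of interest is a momentum times a polynomial in momenta only. -/
theorem moyal_coord_mul_of_pd_eq_zero (j : Fin N ⊕ Fin N)
    (ha : pd j.swap (polySymbol a) = fun _ => 0) (hf : ContDiff ℝ ∞ f) (z : Phase N) :
    moyal ħ (polySymbol (MvPolynomial.X j * a)) f z =
      moyal ħ (polySymbol a) (bopp ħ j f) z := by
  have h : moyal ħ (polySymbol a) (bopp ħ j f) z =
      moyal ħ (polySymbol a) (fun z => coord j z * f z) z +
        Complex.I * ħ / 2 * sgn j * moyal ħ (polySymbol a) (pd j.swap f) z := by
    rw [← moyal_const_mul_right a _ (contDiff_pd hf), ← moyal_add_right a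
      (contDiff_coord.mul hf) (contDiff_const.mul (contDiff_pd hf))]
    rfl
  have h0 : moyal ħ (fun _ : Phase N => 0) f z = 0 := by
    simp [moyal, poissonPow_zero_left]
  rw [h, moyal_coord_mul_left a j hf, moyal_coord_mul_right a j hf, ha, h0]
  ring

/-- Moyal multiplication from the right by a polynomial, through complex conjugation. -/
theorem conj_moyal_conj (f : Phase N → ℂ) (z : Phase N) :
    conj (moyal ħ (symbolAdjoint (polySymbol b)) (fun z => conj (f z)) z) =
      moyal ħ f (polySymbol b) z := by
  rw [moyal, moyal, Complex.conj_tsum]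
  refine tsum_congr fun l => ?_
  rw [map_mul, conj_poissonPow, poissonPow_comm]
  simp only [symbolAdjoint, Complex.conj_conj, map_div₀, map_pow, map_mul, Complex.conj_I,
    Complex.conj_ofReal, map_natCast, map_ofNat]
  rw [← mul_assoc, neg_mul, neg_div, neg_pow, mul_div_assoc]
  -- One sign `(-1)ˡ` comes from conjugating `i`, the other from reversing the factors.
  rw [show (-1 : ℂ) ^ l * ((Complex.I * ħ / 2) ^ l / (l.factorial : ℂ)) * (-1) ^ l =
    ((-1) ^ l * (-1) ^ l) * ((Complex.I * ħ / 2) ^ l / (l.factorial : ℂ)) by ring, ← mul_pow]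
  simp

theorem sum_range_two_mul {A : Type*} [AddCommMonoid A] (h : ℕ → A) (M : ℕ) :
    ∑ l ∈ Finset.range (2 * M), h l = ∑ j ∈ Finset.range M, (h (2 * j) + h (2 * j + 1)) := by
  induction M with
  | zero => simp
  | succ M ih =>
    rw [Nat.mul_succ, Finset.sum_range_succ, Finset.sum_range_succ, ih, Finset.sum_range_succ,
      add_assoc]

/-- The divergence form of the Moyal bracket. -/
theorem moyal_commutator (hf : ContDiff ℝ ∞ f) (z : Phase N) :
    moyal ħ f (polySymbol b) z - moyal ħ (polySymbol b) f z =
      Complex.I * ħ * (∑ n, dx n (sincProd ħ f (dp n (polySymbol b))) z -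
        ∑ n, dp n (sincProd ħ f (dx n (polySymbol b))) z) := by
  obtain ⟨M₀, hM₀⟩ := exists_poissonPow_polySymbol_eq_zero b
  choose M₁ hM₁ using fun i => exists_poissonPow_polySymbol_eq_zero (MvPolynomial.pderiv i b)
  -- A cutoff valid at once for `b` and for all its first partial derivatives, which occur in the
  -- sinc products.
  set M := M₀ + ∑ i, M₁ i with hM
  have hle : ∀ i, M₁ i ≤ M := fun i =>
    (Finset.single_le_sum (f := M₁) (fun _ _ => Nat.zero_le _) (Finset.mem_univ i)).trans
      (Nat.le_add_left _ _)
  -- By antisymmetry the even powers of `Λ` cancel and the odd ones double.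
  have hl : moyal ħ f (polySymbol b) z - moyal ħ (polySymbol b) f z =
      ∑ j ∈ Finset.range M, 2 * ((Complex.I * ħ / 2) ^ (2 * j + 1) /
        ((2 * j + 1).factorial : ℂ) * poissonPow (2 * j + 1) f (polySymbol b) z) := by
    rw [moyal_eq_sum (M := 2 * M) fun l hl => hM₀ l (by omega) f hf z,
      moyal_eq_sum (M := 2 * M) fun l hl => by
        rw [poissonPow_comm, hM₀ l (by omega) f hf z, mul_zero], ← Finset.sum_sub_distrib,
      sum_range_two_mul]
    refine Finset.sum_congr rfl fun j _ => ?_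
    rw [poissonPow_comm (2 * j) (polySymbol b) f, poissonPow_comm (2 * j + 1) (polySymbol b) f]
    rw [pow_succ (-1 : ℂ), pow_mul (-1 : ℂ)]
    norm_num
    ring
  have hpd : ∀ i k : Fin N ⊕ Fin N, pd k (sincProd ħ f (pd i (polySymbol b))) z =
      ∑ j ∈ Finset.range M, (-1 : ℂ) ^ j * (ħ / 2 : ℂ) ^ (2 * j) / ((2 * j + 1).factorial : ℂ) *
        (poissonPow (2 * j) (pd k f) (pd i (polySymbol b)) z +
          poissonPow (2 * j) f (pd k (pd i (polySymbol b))) z) := by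
    intro i k
    have hc : ContDiff ℝ ∞ (pd i (polySymbol b)) := contDiff_pd (contDiff_polySymbol b)
    have hcP : ∀ l, ContDiff ℝ ∞ (poissonPow l f (pd i (polySymbol b))) := fun l =>
      contDiff_poissonPow l hf hc
    have : sincProd ħ f (pd i (polySymbol b)) = fun z => ∑ j ∈ Finset.range M,
        (-1 : ℂ) ^ j * (ħ / 2 : ℂ) ^ (2 * j) / ((2 * j + 1).factorial : ℂ) *
          poissonPow (2 * j) f (pd i (polySymbol b)) z :=
      funext fun z => sincProd_eq_sum fun l hl => by
        rw [pd_polySymbol]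
        exact hM₁ i l ((hle i).trans hl) f hf z
    rw [this, pd_sum fun j _ => contDiff_const.mul (hcP _)]
    refine Finset.sum_congr rfl fun j _ => ?_
    rw [pd_const_mul _ (hcP _)]
    beta_reduce
    rw [pd_poissonPow _ hf hc]
  simp only [dx_eq_pd, dp_eq_pd, hl, hpd]
  rw [Finset.sum_comm, Finset.sum_comm (s := Finset.univ) (t := Finset.range M),
    ← Finset.sum_sub_distrib, Finset.mul_sum]
  refine Finset.sum_congr rfl fun j _ => ?_
  rw [← Finset.mul_sum, ← Finset.mul_sum, ← mul_sub, ← Finset.sum_sub_distrib]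
  -- One factor `Λ` is split off. The added terms with mixed second derivatives of `b` cancel in
  -- pairs and complete the Leibniz expansion of the divergence.
  have hP : poissonPow (2 * j + 1) f (polySymbol b) z = ∑ n : Fin N,
      (poissonPow (2 * j) (pd (Sum.inr n) f) (pd (Sum.inl n) (polySymbol b)) z +
        poissonPow (2 * j) f (pd (Sum.inr n) (pd (Sum.inl n) (polySymbol b))) z -
      (poissonPow (2 * j) (pd (Sum.inl n) f) (pd (Sum.inr n) (polySymbol b)) z +
        poissonPow (2 * j) f (pd (Sum.inl n) (pd (Sum.inr n) (polySymbol b))) z)) := by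
    rw [poissonPow]
    refine Finset.sum_congr rfl fun n _ => ?_
    rw [pd_comm (i := Sum.inr n) (contDiff_polySymbol b), dx_eq_pd, dp_eq_pd]
    ring
  -- The constants agree because `2 (iħ/2)²ʲ⁺¹ = iħ (-1)ʲ (ħ/2)²ʲ`.
  rw [← hP, pow_succ, div_pow, mul_pow, pow_mul Complex.I, Complex.I_sq, div_pow]
  ring

end Moyal

/-! ### The Wigner transform of Schwartz kernels -/

section Wigner

variable {ħ : ℝ}

/-- The change of variables `(x, ξ) ↦ (x + ξ/2, x - ξ/2)`. -/
def midpointEquiv (N : ℕ) : (Config N × Config N) ≃L[ℝ] (Config N × Config N) :=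
  LinearEquiv.toContinuousLinearEquiv
    { toFun := fun w => (w.1 + (1 / 2 : ℝ) • w.2, w.1 - (1 / 2 : ℝ) • w.2)
      invFun := fun w => ((1 / 2 : ℝ) • (w.1 + w.2), w.1 - w.2)
      map_add' := fun v w => by ext <;> simp <;> ring
      map_smul' := fun c w => by ext <;> simp <;> ring
      left_inv := fun w => by ext <;> simp <;> ring
      right_inv := fun w => by ext <;> simp <;> ring }

theorem midpointEquiv_apply (w : Config N × Config N) :
    midpointEquiv N w = (w.1 + (1 / 2 : ℝ) • w.2, w.1 - (1 / 2 : ℝ) • w.2) := rfl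

/-- A kernel in the midpoint and relative coordinates. -/
def toMidpoint (K : 𝓢(Config N × Config N, ℂ)) : 𝓢(Config N × Config N, ℂ) :=
  compCLMOfContinuousLinearEquiv ℂ (midpointEquiv N) K

theorem toMidpoint_apply (K : 𝓢(Config N × Config N, ℂ)) (w : Config N × Config N) :
    toMidpoint K w = K (w.1 + (1 / 2 : ℝ) • w.2, w.1 - (1 / 2 : ℝ) • w.2) := rfl

theorem wigner_eq_pft (ħ : ℝ) (K : 𝓢(Config N × Config N, ℂ)) :
    wigner ħ K = fun z => ((1 / (2 * Real.pi * ħ : ℝ) ^ N : ℝ) : ℂ) * pft ħ (toMidpoint K) z :=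
  rfl

theorem exists_schwartzMap_wigner (hħ : ħ ≠ 0) (K : 𝓢(Config N × Config N, ℂ)) :
    ∃ F : 𝓢(Phase N, ℂ), ⇑F = wigner ħ K := by
  obtain ⟨F, hF⟩ := exists_schwartzMap_pft hħ (toMidpoint K)
  refine ⟨((1 / (2 * Real.pi * ħ : ℝ) ^ N : ℝ) : ℂ) • F, ?_⟩
  rw [wigner_eq_pft, ← hF]
  rfl

theorem contDiff_wigner (hħ : ħ ≠ 0) (K : 𝓢(Config N × Config N, ℂ)) :
    ContDiff ℝ ∞ (wigner ħ K) := by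
  obtain ⟨F, hF⟩ := exists_schwartzMap_wigner hħ K
  exact hF ▸ F.smooth _

theorem contDiff_pft (hħ : ħ ≠ 0) (K : 𝓢(Config N × Config N, ℂ)) :
    ContDiff ℝ ∞ (pft ħ K) := by
  obtain ⟨F, hF⟩ := exists_schwartzMap_pft hħ K
  exact hF ▸ F.smooth _

theorem wigner_add (ħ : ℝ) (K₁ K₂ : 𝓢(Config N × Config N, ℂ)) (z : Phase N) :
    wigner ħ (K₁ + K₂ : 𝓢(Config N × Config N, ℂ)) z = wigner ħ K₁ z + wigner ħ K₂ z := by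
  simp only [wigner_eq_pft]
  rw [toMidpoint, map_add, pft_add, mul_add]
  rfl

theorem wigner_smul (ħ : ℝ) (c : ℂ) (K : 𝓢(Config N × Config N, ℂ)) (z : Phase N) :
    wigner ħ (c • K : 𝓢(Config N × Config N, ℂ)) z = c * wigner ħ K z := by
  simp only [wigner_eq_pft]
  rw [toMidpoint, map_smul, pft_const_smul, mul_left_comm]
  rfl

/-- The direction of the `n`-th coordinate of the first argument of a kernel. -/
def firstVec (n : Fin N) : Config N × Config N := (EuclideanSpace.single n 1, 0)

/-- Multiplication of a kernel from the left by the momentum operator `-iħ ∂/∂xₙ`. -/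
def momentum (ħ : ℝ) (n : Fin N) (K : 𝓢(Config N × Config N, ℂ)) :
    𝓢(Config N × Config N, ℂ) :=
  (-Complex.I * ħ) • (∂_{firstVec n} K : 𝓢(Config N × Config N, ℂ))

/-- The first argument of the kernel is `x + ξ/2`, and under the transform the factor `ξ/2` is
`(iħ/2) ∂/∂p`. -/
theorem wigner_position (hħ : ħ ≠ 0) (n : Fin N) (K : 𝓢(Config N × Config N, ℂ)) :
    wigner ħ (mulCLM (coordCLM (Sum.inl n)) K) = bopp ħ (Sum.inr n) (wigner ħ K) := by
  have h : toMidpoint (mulCLM (coordCLM (Sum.inl n)) K) =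
      mulCLM (coordCLM (Sum.inl n)) (toMidpoint K) +
        (1 / 2 : ℂ) • mulCLM (coordCLM (Sum.inr n)) (toMidpoint K) := by
    ext w
    simp [toMidpoint_apply]
    ring
  have hc : (ħ : ℂ) ≠ 0 := by exact_mod_cast hħ
  ext z
  simp only [bopp, wigner_eq_pft, h, pft_add, pft_const_smul, Sum.swap_inr, sgn_inr, coord,
    coordCLM_inr]
  rw [pd_const_mul _ (contDiff_pft hħ _), pd_inl_pft, ← coord_inr_mul_pft]
  simp only [pft_const_smul]
  field_simp
  rw [Complex.I_sq]
  ring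

theorem wigner_momentum (hħ : ħ ≠ 0) (n : Fin N) (K : 𝓢(Config N × Config N, ℂ)) :
    wigner ħ (momentum ħ n K) = bopp ħ (Sum.inl n) (wigner ħ K) := by
  -- In midpoint coordinates the derivative in the first argument is `½ ∂ₓ + ∂_ξ`; the second term
  -- yields multiplication by `p`.
  have hv : midpointEquiv N ((1 / 2 : ℝ) • (EuclideanSpace.single n 1 : Config N),
      EuclideanSpace.single n 1) = firstVec n := by
    rw [midpointEquiv_apply, firstVec]
    refine Prod.ext ?_ (sub_self _)
    rw [← add_smul]
    norm_num
  have h : toMidpoint (momentum ħ n K) = (-Complex.I * ħ) •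
      ((1 / 2 : ℂ) • (∂_{((EuclideanSpace.single n 1 : Config N), (0 : Config N))}
          (toMidpoint K) : 𝓢(Config N × Config N, ℂ))) +
        (-Complex.I * ħ) • (∂_{((0 : Config N), (EuclideanSpace.single n 1 : Config N))}
          (toMidpoint K) : 𝓢(Config N × Config N, ℂ)) := by
    rw [momentum, toMidpoint, map_smul, ← hv, ← lineDerivOp_compCLMOfContinuousLinearEquiv]
    ext w
    have e : (((1 / 2 : ℝ) • (EuclideanSpace.single n 1 : Config N),
        (EuclideanSpace.single n 1 : Config N)) : Config N × Config N) =
        (1 / 2 : ℝ) • ((EuclideanSpace.single n 1 : Config N), (0 : Config N)) +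
          ((0 : Config N), (EuclideanSpace.single n 1 : Config N)) := by simp
    simp only [smul_apply, add_apply, lineDerivOp_apply_eq_fderiv, e, map_add, map_smul,
      smul_eq_mul, Complex.real_smul, toMidpoint]
    push_cast
    ring
  ext z
  simp only [bopp, wigner_eq_pft, h, pft_add, pft_const_smul, Sum.swap_inl, sgn_inl, coord,
    coordCLM_inl]
  have hp := coord_inl_mul_pft hħ (toMidpoint K) n z
  rw [pft_const_smul] at hp
  rw [pd_const_mul _ (contDiff_pft hħ _), pd_inr_pft]
  linear_combination (-((1 / (2 * Real.pi * ħ : ℝ) ^ N : ℝ) : ℂ)) * hp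

end Wigner

/-! ### Weyl quantization of polynomials -/

section Weyl

variable {ħ : ℝ} (a b : MvPolynomial (Fin N ⊕ Fin N) ℂ) (ψ : 𝓢(Config N, ℂ)) (x q : Config N)

/-- The inner integral in the definition of `weylOp`. -/
def weylInner (ħ : ℝ) (a : Phase N → ℂ) (ψ : Config N → ℂ) (x q : Config N) : ℂ :=
  ∫ y : Config N,
    a (q, (1 / 2 : ℝ) • (x + y)) * Complex.exp (Complex.I * (inner ℝ q (x - y) / ħ : ℝ)) * ψ y

theorem weylOp_eq (a : Phase N → ℂ) (ψ : Config N → ℂ) (x : Config N) :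
    weylOp ħ a ψ x = (1 / (2 * Real.pi * ħ : ℝ) ^ N : ℝ) * ∫ q, weylInner ħ a ψ x q := rfl

/-- Multiplication by a coordinate on the Schwartz space. -/
def position (n : Fin N) (ψ : 𝓢(Config N, ℂ)) : 𝓢(Config N, ℂ) :=
  mulCLM (EuclideanSpace.proj n) ψ

@[simp] theorem position_apply (n : Fin N) (y : Config N) : position n ψ y = y n * ψ y := by
  simp [position]

theorem norm_exp_I_mul (r : ℝ) : ‖Complex.exp (Complex.I * (r : ℂ))‖ = 1 := by
  rw [mul_comm, Complex.norm_exp_ofReal_mul_I]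

theorem integrable_weylInner : Integrable fun y : Config N =>
    polySymbol a (q, (1 / 2 : ℝ) • (x + y)) *
      Complex.exp (Complex.I * (inner ℝ q (x - y) / ħ : ℝ)) * ψ y := by
  induction a using MvPolynomial.induction_on generalizing ψ with
  | C c =>
    refine ψ.integrable.bdd_mul (c := ‖c‖) (by simp only [polySymbol_C]; fun_prop)
      (.of_forall fun y => ?_)
    rw [norm_mul, norm_exp_I_mul, polySymbol_C, mul_one]
  | add p r hp hr =>
    refine ((hp ψ).add (hr ψ)).congr (.of_forall fun y => ?_)
    simp only [polySymbol_add, Pi.add_apply]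
    ring
  | mul_X p i hp =>
    rcases i with n | n
    · refine ((hp ψ).const_mul (q n : ℂ)).congr (.of_forall fun y => ?_)
      simp only [polySymbol_mul, polySymbol_X, coord, coordCLM_inl]
      ring
    · refine ((((hp ψ).const_mul (x n : ℂ)).add (hp (position n ψ))).const_mul
        (1 / 2 : ℂ)).congr (.of_forall fun y => ?_)
      simp [polySymbol_mul, polySymbol_X, coord]
      ring

theorem weylInner_add : weylInner ħ (polySymbol (a + b)) ψ x q =
    weylInner ħ (polySymbol a) ψ x q + weylInner ħ (polySymbol b) ψ x q := by
  rw [weylInner, weylInner, weylInner,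
    ← integral_add (integrable_weylInner a ψ x q) (integrable_weylInner b ψ x q)]
  simp only [polySymbol_add, add_mul]

theorem weylInner_C_mul (c : ℂ) : weylInner ħ (polySymbol (MvPolynomial.C c * a)) ψ x q =
    c * weylInner ħ (polySymbol a) ψ x q := by
  rw [weylInner, weylInner, ← integral_const_mul]
  simp only [polySymbol_C_mul, mul_assoc]

theorem weylInner_X_inl_mul (n : Fin N) :
    weylInner ħ (polySymbol (MvPolynomial.X (Sum.inl n) * a)) ψ x q =
      q n * weylInner ħ (polySymbol a) ψ x q := by
  rw [weylInner, weylInner, ← integral_const_mul]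
  simp only [polySymbol_X_mul, mul_assoc, coord, coordCLM_inl]

theorem weylInner_X_inr_mul (n : Fin N) :
    weylInner ħ (polySymbol (MvPolynomial.X (Sum.inr n) * a)) ψ x q = 1 / 2 *
      (x n * weylInner ħ (polySymbol a) ψ x q +
        weylInner ħ (polySymbol a) (position n ψ) x q) := by
  simp only [weylInner]
  rw [← integral_const_mul (x n : ℂ), ← integral_add
    ((integrable_weylInner a ψ x q).const_mul _) (integrable_weylInner a (position n ψ) x q),
    ← integral_const_mul]
  congr with y
  simp [polySymbol_X_mul, coord]
  ring

theorem polySymbol_rename_inl (b : MvPolynomial (Fin N) ℂ) (x y : Config N) :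
    polySymbol (MvPolynomial.rename Sum.inl b) (q, x) =
      polySymbol (MvPolynomial.rename Sum.inl b) (q, y) := by
  simp only [polySymbol, MvPolynomial.aeval_rename, Sum.elim_comp_inl]

theorem weylInner_rename_inl (b : MvPolynomial (Fin N) ℂ) :
    weylInner ħ (polySymbol (MvPolynomial.rename Sum.inl b)) ψ x q =
      polySymbol (MvPolynomial.rename Sum.inl b) (q, 0) *
        Complex.exp (Complex.I * (inner ℝ q x / ħ : ℝ)) * 𝓕 ψ ((2 * Real.pi * ħ)⁻¹ • q) := by
  rw [fourier_coe, fourier_eq_integral, ← integral_const_mul, weylInner]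
  congr with y
  rw [polySymbol_rename_inl q b _ 0, inner_sub_right, sub_div, Complex.ofReal_sub, mul_sub,
    sub_eq_add_neg, Complex.exp_add, neg_mul]
  ring

/-- For a symbol in momenta only, the inner integral is a Fourier transform of `ψ`, so a further
factor `qₙ` is absorbed as `-iħ ∂ₙ` acting on `ψ`. A position-dependent symbol would itself be
differentiated, which is why momenta are built up before positions. -/
theorem weylInner_X_inl_mul_rename_inl (hħ : ħ ≠ 0) (b : MvPolynomial (Fin N) ℂ) (n : Fin N) :
    weylInner ħ (polySymbol (MvPolynomial.X (Sum.inl n) * MvPolynomial.rename Sum.inl b)) ψ x q =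
      weylInner ħ (polySymbol (MvPolynomial.rename Sum.inl b)) ((-Complex.I * ħ) •
        (∂_{(EuclideanSpace.single n 1 : Config N)} ψ : 𝓢(Config N, ℂ)) :
          𝓢(Config N, ℂ)) x q := by
  rw [weylInner_X_inl_mul, weylInner_rename_inl, weylInner_rename_inl,
    FourierTransform.fourier_smul, fourier_lineDerivOp_eq, smul_apply, smul_apply,
    smulLeftCLM_apply_apply (by fun_prop)]
  have : (Real.pi : ℂ) ≠ 0 := by exact_mod_cast Real.pi_ne_zero
  have : (ħ : ℂ) ≠ 0 := by exact_mod_cast hħ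
  simp only [EuclideanSpace.inner_single_right, PiLp.smul_apply, smul_eq_mul, Complex.real_smul]
  simp
  field_simp
  simp

/-- The outer integral in the definition of `weylOp` converges. -/
def WeylIntegrable (ħ : ℝ) (a : MvPolynomial (Fin N ⊕ Fin N) ℂ) : Prop :=
  ∀ (ψ : 𝓢(Config N, ℂ)) (x : Config N), Integrable (weylInner ħ (polySymbol a) ψ x)

theorem weylIntegrable_one (hħ : ħ ≠ 0) :
    WeylIntegrable ħ (1 : MvPolynomial (Fin N ⊕ Fin N) ℂ) := by
  intro ψ x
  have h := ((𝓕 ψ).integrable (μ := volume)).comp_smul (R := (2 * Real.pi * ħ)⁻¹)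
    (by have := Real.pi_ne_zero; positivity)
  refine (h.bdd_mul (c := 1) (f := fun q : Config N =>
    Complex.exp (Complex.I * (inner ℝ q x / ħ : ℝ))) (by fun_prop)
    (.of_forall fun q => (norm_exp_I_mul _).le)).congr (.of_forall fun q => ?_)
  have := weylInner_rename_inl (ħ := ħ) ψ x q 1
  rw [map_one, polySymbol_one, one_mul] at this
  rw [polySymbol_one, this]

/-- Fourier inversion after rescaling `q` by `2πħ`; the Jacobian cancels the prefactor. -/
theorem weylOp_one (hħ : 0 < ħ) :
    weylOp ħ (polySymbol (1 : MvPolynomial (Fin N ⊕ Fin N) ℂ)) ψ x = ψ x := by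
  have hpos : 0 < 2 * Real.pi * ħ := by positivity
  obtain ⟨g, hg⟩ : ∃ g : Config N → ℂ, g = fun k =>
      Complex.exp (((2 * Real.pi * inner ℝ k x : ℝ) : ℂ) * Complex.I) • 𝓕 ψ k := ⟨_, rfl⟩
  have h : weylInner ħ (polySymbol (1 : MvPolynomial (Fin N ⊕ Fin N) ℂ)) ψ x =
      fun q => g ((2 * Real.pi * ħ)⁻¹ • q) := by
    ext q
    rw [hg]
    have := weylInner_rename_inl (ħ := ħ) ψ x q 1
    rw [map_one] at this
    rw [this, polySymbol_one, one_mul]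
    beta_reduce
    rw [smul_eq_mul, inner_smul_left, mul_comm Complex.I]
    congr 4
    have := Real.pi_ne_zero
    simp
    field_simp
  rw [weylOp_eq, h, Measure.integral_comp_smul, hg, fourier_coe, ← Real.fourierInv_eq',
    ← fourier_coe, ← fourierInv_coe, FourierTransform.fourierInv_fourier_eq, finrank_euclideanSpace,
    Fintype.card_fin, inv_pow, inv_inv, abs_of_pos (by positivity), Complex.real_smul, ← mul_assoc,
    ← Complex.ofReal_mul, one_div, inv_mul_cancel₀ (by positivity)]
  simp

variable {a b}

theorem WeylIntegrable.add (ha : WeylIntegrable ħ a) (hb : WeylIntegrable ħ b) :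
    WeylIntegrable ħ (a + b) := fun ψ x =>
  ((ha ψ x).add (hb ψ x)).congr (.of_forall fun q => (weylInner_add a b ψ x q).symm)

theorem WeylIntegrable.C_mul (c : ℂ) (ha : WeylIntegrable ħ a) :
    WeylIntegrable ħ (MvPolynomial.C c * a) := fun ψ x =>
  ((ha ψ x).const_mul c).congr (.of_forall fun q => (weylInner_C_mul a ψ x q c).symm)

theorem WeylIntegrable.X_inr_mul (n : Fin N) (ha : WeylIntegrable ħ a) :
    WeylIntegrable ħ (MvPolynomial.X (Sum.inr n) * a) := fun ψ x =>
  ((((ha ψ x).const_mul (x n : ℂ)).add (ha (position n ψ) x)).const_mul (1 / 2 : ℂ)).congr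
    (.of_forall fun q => (weylInner_X_inr_mul a ψ x q n).symm)

theorem weylOp_add (ha : WeylIntegrable ħ a) (hb : WeylIntegrable ħ b) :
    weylOp ħ (polySymbol (a + b)) ψ x =
      weylOp ħ (polySymbol a) ψ x + weylOp ħ (polySymbol b) ψ x := by
  simp only [weylOp_eq, weylInner_add]
  rw [integral_add (ha ψ x) (hb ψ x), mul_add]

theorem weylOp_C_mul (c : ℂ) : weylOp ħ (polySymbol (MvPolynomial.C c * a)) ψ x =
    c * weylOp ħ (polySymbol a) ψ x := by
  simp only [weylOp_eq, weylInner_C_mul]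
  rw [integral_const_mul, mul_left_comm]

theorem weylOp_X_inr_mul (n : Fin N) (ha : WeylIntegrable ħ a) :
    weylOp ħ (polySymbol (MvPolynomial.X (Sum.inr n) * a)) ψ x = 1 / 2 *
      (x n * weylOp ħ (polySymbol a) ψ x + weylOp ħ (polySymbol a) (position n ψ) x) := by
  simp only [weylOp_eq, weylInner_X_inr_mul]
  rw [integral_const_mul, integral_add ((ha ψ x).const_mul _) (ha _ x), integral_const_mul]
  ring

end Weyl

/-! ### Products of polynomial operators with Schwartz kernels -/

section KernelProducts

variable {ħ : ℝ} {a b : MvPolynomial (Fin N ⊕ Fin N) ℂ}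

/-- The kernel `K` with its second argument fixed. -/
def column (K : 𝓢(Config N × Config N, ℂ)) (y : Config N) : 𝓢(Config N, ℂ) :=
  slice (compCLMOfContinuousLinearEquiv ℂ
    (ContinuousLinearEquiv.prodComm ℝ (Config N) (Config N)) K) y

theorem column_apply (K : 𝓢(Config N × Config N, ℂ)) (y x : Config N) :
    column K y x = K (x, y) := rfl

theorem opMulKer_eq (a : Phase N → ℂ) (K : 𝓢(Config N × Config N, ℂ)) (w : Config N × Config N) :
    opMulKer ħ a K w = weylOp ħ a (column K w.2) w.1 := rfl

theorem column_position (n : Fin N) (K : 𝓢(Config N × Config N, ℂ)) (y : Config N) :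
    column (mulCLM (coordCLM (Sum.inl n)) K) y = position n (column K y) := by
  ext x
  simp [column_apply]

theorem column_momentum (n : Fin N) (K : 𝓢(Config N × Config N, ℂ)) (y : Config N) :
    column (momentum ħ n K) y = (-Complex.I * ħ) •
      (∂_{(EuclideanSpace.single n 1 : Config N)} (column K y) : 𝓢(Config N, ℂ)) := by
  ext x
  have h : HasFDerivAt (fun x : Config N => (x, y))
      (ContinuousLinearMap.inl ℝ (Config N) (Config N)) x := hasFDerivAt_prodMk_left x y
  have := ((K.hasFDerivAt (x, y)).comp x h).fderiv
  rw [smul_apply, lineDerivOp_apply_eq_fderiv,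
    show ⇑(column K y) = K ∘ fun x => (x, y) from rfl, this, column_apply, momentum, smul_apply,
    lineDerivOp_apply_eq_fderiv]
  simp [firstVec]

/-- Left multiplication of Schwartz kernels by the operator with Weyl symbol `a` is well defined
and corresponds to left Moyal multiplication of Wigner functions. -/
structure IsMoyalSymbol (ħ : ℝ) (a : MvPolynomial (Fin N ⊕ Fin N) ℂ) : Prop where
  integrable : WeylIntegrable ħ a
  exists_kernel (K : 𝓢(Config N × Config N, ℂ)) : ∃ K' : 𝓢(Config N × Config N, ℂ),
    ⇑K' = opMulKer ħ (polySymbol a) K ∧ wigner ħ K' = moyal ħ (polySymbol a) (wigner ħ K)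

namespace IsMoyalSymbol

protected theorem one (hħ : 0 < ħ) :
    IsMoyalSymbol ħ (1 : MvPolynomial (Fin N ⊕ Fin N) ℂ) where
  integrable := weylIntegrable_one hħ.ne'
  exists_kernel K := by
    refine ⟨K, funext fun w => ?_, by rw [moyal_one]⟩
    rw [opMulKer_eq, weylOp_one _ _ hħ, column_apply]

protected theorem add (hħ : ħ ≠ 0) (ha : IsMoyalSymbol ħ a) (hb : IsMoyalSymbol ħ b) :
    IsMoyalSymbol ħ (a + b) where
  integrable := ha.integrable.add hb.integrable
  exists_kernel K := by
    obtain ⟨K₁, h₁, w₁⟩ := ha.exists_kernel K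
    obtain ⟨K₂, h₂, w₂⟩ := hb.exists_kernel K
    refine ⟨K₁ + K₂, funext fun w => ?_, funext fun z => ?_⟩
    · rw [add_apply, h₁, h₂, opMulKer_eq, opMulKer_eq, opMulKer_eq,
        weylOp_add _ _ ha.integrable hb.integrable]
    · rw [wigner_add, w₁, w₂, moyal_add_left a b (contDiff_wigner hħ K)]

protected theorem C_mul (c : ℂ) (ha : IsMoyalSymbol ħ a) :
    IsMoyalSymbol ħ (MvPolynomial.C c * a) where
  integrable := ha.integrable.C_mul c
  exists_kernel K := by
    obtain ⟨K₁, h₁, w₁⟩ := ha.exists_kernel K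
    refine ⟨c • K₁, funext fun w => ?_, funext fun z => ?_⟩
    · rw [smul_apply, h₁, opMulKer_eq, opMulKer_eq, weylOp_C_mul, smul_eq_mul]
    · rw [wigner_smul, w₁, moyal_C_mul_left]

/-- The midpoint `(x + y)/2` in the Weyl integral makes the new operator `½ (x̂ₙ Â + Â x̂ₙ)`, and
`moyal_coord_mul_eq_half` is the same symmetrization for Moyal products. -/
protected theorem X_inr_mul (hħ : ħ ≠ 0) (n : Fin N) (ha : IsMoyalSymbol ħ a) :
    IsMoyalSymbol ħ (MvPolynomial.X (Sum.inr n) * a) where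
  integrable := ha.integrable.X_inr_mul n
  exists_kernel K := by
    obtain ⟨K₁, h₁, w₁⟩ := ha.exists_kernel K
    obtain ⟨K₂, h₂, w₂⟩ := ha.exists_kernel (mulCLM (coordCLM (Sum.inl n)) K)
    refine ⟨(1 / 2 : ℂ) • (mulCLM (coordCLM (Sum.inl n)) K₁ + K₂), funext fun w => ?_,
      funext fun z => ?_⟩
    · rw [smul_apply, add_apply, mulCLM_apply, h₁, h₂, opMulKer_eq, opMulKer_eq, opMulKer_eq,
        weylOp_X_inr_mul _ _ n ha.integrable, column_position, smul_eq_mul, coordCLM_inl]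
    · rw [wigner_smul, wigner_add, wigner_position hħ, w₁, w₂, wigner_position hħ,
        moyal_coord_mul_eq_half a _ (contDiff_wigner hħ K)]

protected theorem X_inl_mul_rename_inl (hħ : ħ ≠ 0) (n : Fin N) {b : MvPolynomial (Fin N) ℂ}
    (hb : IsMoyalSymbol ħ (MvPolynomial.rename Sum.inl b)) :
    IsMoyalSymbol ħ (MvPolynomial.X (Sum.inl n) * MvPolynomial.rename Sum.inl b) where
  integrable := fun ψ x => (hb.integrable _ x).congr
    (.of_forall fun q => (weylInner_X_inl_mul_rename_inl ψ x q hħ b n).symm)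
  exists_kernel K := by
    obtain ⟨K₁, h₁, w₁⟩ := hb.exists_kernel (momentum ħ n K)
    refine ⟨K₁, funext fun w => ?_, funext fun z => ?_⟩
    · rw [h₁, opMulKer_eq, opMulKer_eq, column_momentum, weylOp_eq, weylOp_eq]
      simp only [weylInner_X_inl_mul_rename_inl _ _ _ hħ]
    -- The symbol is constant along positions, so its `xₙ`-derivative vanishes and the unsymmetrized
    -- rule applies.
    · have h0 : pd (Sum.inl n).swap (polySymbol (MvPolynomial.rename Sum.inl b)) =
          fun _ : Phase N => 0 := by
        ext z
        have hf : HasFDerivAt (polySymbol (MvPolynomial.rename Sum.inl b)) _ (z.1, z.2) :=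
          ((contDiff_polySymbol (MvPolynomial.rename Sum.inl b)).differentiable
            (by simp) z).hasFDerivAt
        have hl := (hf.comp z.2 (hasFDerivAt_prodMk_right (𝕜 := ℝ) z.1 z.2)).fderiv
        simp only [Function.comp_def] at hl
        have hc : (fun x => polySymbol (MvPolynomial.rename Sum.inl b) (z.1, x)) = fun _ =>
            polySymbol (MvPolynomial.rename Sum.inl b) (z.1, (0 : Config N)) :=
          funext fun x => polySymbol_rename_inl z.1 b x 0
        rw [hc, fderiv_fun_const] at hl
        simpa [pd, basisVec] using
          (DFunLike.congr_fun hl (EuclideanSpace.single n 1 : Config N)).symm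
      rw [w₁, wigner_momentum hħ, moyal_coord_mul_of_pd_eq_zero _ _ h0 (contDiff_wigner hħ K)]

theorem rename_inl (hħ : 0 < ħ) (b : MvPolynomial (Fin N) ℂ) :
    IsMoyalSymbol ħ (MvPolynomial.rename (Sum.inl : Fin N → Fin N ⊕ Fin N) b) := by
  induction b using MvPolynomial.induction_on with
  | C c =>
    rw [MvPolynomial.rename_C, ← mul_one (MvPolynomial.C c)]
    exact (IsMoyalSymbol.one hħ).C_mul c
  | add p q hp hq =>
    rw [map_add]
    exact hp.add hħ.ne' hq
  | mul_X p n hp =>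
    rw [map_mul, MvPolynomial.rename_X, mul_comm]
    exact hp.X_inl_mul_rename_inl hħ.ne' n

theorem rename_inr_mul (hħ : ħ ≠ 0) (ha : IsMoyalSymbol ħ a) (c : MvPolynomial (Fin N) ℂ) :
    IsMoyalSymbol ħ (MvPolynomial.rename Sum.inr c * a) := by
  induction c using MvPolynomial.induction_on with
  | C c =>
    rw [MvPolynomial.rename_C]
    exact ha.C_mul c
  | add p q hp hq =>
    rw [map_add, add_mul]
    exact hp.add hħ hq
  | mul_X p n hp =>
    rw [map_mul, MvPolynomial.rename_X, mul_comm (MvPolynomial.rename _ _), mul_assoc]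
    exact hp.X_inr_mul hħ n

/-- The available steps add momenta only to polynomials in momenta, and positions afterwards. The
prefactors `b` and `c` therefore collect the variables of `a`, sorted by type, until only a constant
is left. -/
theorem rename_mul (hħ : 0 < ħ) (a : MvPolynomial (Fin N ⊕ Fin N) ℂ)
    (b c : MvPolynomial (Fin N) ℂ) :
    IsMoyalSymbol ħ (MvPolynomial.rename Sum.inr c * MvPolynomial.rename Sum.inl b * a) := by
  induction a using MvPolynomial.induction_on generalizing b c with
  | C k =>
    rw [mul_comm]
    exact ((rename_inl hħ b).rename_inr_mul hħ.ne' c).C_mul k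
  | add p q hp hq =>
    rw [mul_add]
    exact (hp b c).add hħ.ne' (hq b c)
  | mul_X p i hp =>
    rcases i with n | n
    · have := hp (b * MvPolynomial.X n) c
      rw [map_mul, MvPolynomial.rename_X] at this
      convert this using 1
      ring
    · have := hp b (c * MvPolynomial.X n)
      rw [map_mul, MvPolynomial.rename_X] at this
      convert this using 1
      ring

end IsMoyalSymbol

/-- The Wigner function of `Â K̂` is the Moyal product of the symbol of `Â` and the Wigner function
of `K̂`. -/
theorem exists_opMulKer (hħ : 0 < ħ) (a : MvPolynomial (Fin N ⊕ Fin N) ℂ)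
    (K : 𝓢(Config N × Config N, ℂ)) : ∃ K' : 𝓢(Config N × Config N, ℂ),
      ⇑K' = opMulKer ħ (polySymbol a) K ∧ wigner ħ K' = moyal ħ (polySymbol a) (wigner ħ K) := by
  have h := IsMoyalSymbol.rename_mul hħ a 1 1
  rw [map_one, map_one, one_mul, one_mul] at h
  exact h.exists_kernel K

/-- The adjoint of a Schwartz kernel. -/
def adjointKernel (K : 𝓢(Config N × Config N, ℂ)) : 𝓢(Config N × Config N, ℂ) :=
  postcompCLM (𝕜 := ℝ) (Complex.conjCLE : ℂ →L[ℝ] ℂ)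
    (compCLMOfContinuousLinearEquiv ℝ (ContinuousLinearEquiv.prodComm ℝ (Config N) (Config N)) K)

theorem coe_adjointKernel (K : 𝓢(Config N × Config N, ℂ)) :
    ⇑(adjointKernel K) = kerAdjoint K := by
  ext w
  rfl

/-- The substitution `ξ ↦ -ξ` exchanges the two arguments of the kernel and undoes the conjugation
of the phase. -/
theorem wigner_kerAdjoint (ħ : ℝ) (K : Config N × Config N → ℂ) (z : Phase N) :
    wigner ħ (kerAdjoint K) z = conj (wigner ħ K z) := by
  rw [wigner, wigner, map_mul, Complex.conj_ofReal, ← integral_conj, ← integral_neg_eq_self]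
  congr 2
  ext ξ
  rw [map_mul, ← Complex.exp_conj, map_mul, map_neg, Complex.conj_I, Complex.conj_ofReal,
    kerAdjoint, inner_neg_right, smul_neg, sub_neg_eq_add, ← sub_eq_add_neg, neg_div]
  simp

theorem exists_kerMulOp (hħ : 0 < ħ) (a : MvPolynomial (Fin N ⊕ Fin N) ℂ)
    (K : 𝓢(Config N × Config N, ℂ)) : ∃ K' : 𝓢(Config N × Config N, ℂ),
      ⇑K' = kerMulOp ħ K (polySymbol a) ∧ wigner ħ K' = moyal ħ (wigner ħ K) (polySymbol a) := by
  obtain ⟨K', h, hw⟩ := exists_opMulKer hħ (MvPolynomial.map (starRingEnd ℂ) a) (adjointKernel K)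
  rw [← symbolAdjoint_polySymbol, coe_adjointKernel] at h hw
  refine ⟨adjointKernel K', by rw [coe_adjointKernel, h]; rfl, funext fun z => ?_⟩
  rw [coe_adjointKernel, wigner_kerAdjoint, hw, ← conj_moyal_conj]
  congr 3
  ext z
  exact wigner_kerAdjoint ħ K z

/-- The bracket part of the divergence of the Wigner flow. -/
def flowBracket (ħ : ℝ) (f b : Phase N → ℂ) (z : Phase N) : ℂ :=
  ∑ n, dx n (sincProd ħ f (dp n b)) z - ∑ n, dp n (sincProd ħ f (dx n b)) z

/-- The Wigner function of a commutator with a polynomial operator in divergence form. -/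
theorem exists_kerCommutator (hħ : 0 < ħ) (a : MvPolynomial (Fin N ⊕ Fin N) ℂ)
    (K : 𝓢(Config N × Config N, ℂ)) : ∃ K' : 𝓢(Config N × Config N, ℂ),
      ⇑K' = kerCommutator ħ K (polySymbol a) ∧
        ∀ z, wigner ħ K' z = Complex.I * ħ * flowBracket ħ (wigner ħ K) (polySymbol a) z := by
  obtain ⟨K₁, h₁, w₁⟩ := exists_kerMulOp hħ a K
  obtain ⟨K₂, h₂, w₂⟩ := exists_opMulKer hħ a K
  refine ⟨K₁ + (-1 : ℂ) • K₂, funext fun w => ?_, fun z => ?_⟩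
  · rw [add_apply, smul_apply, h₁, h₂, kerCommutator]
    simp [sub_eq_add_neg]
  · rw [wigner_add, wigner_smul, w₁, w₂, neg_one_mul, ← sub_eq_add_neg,
      moyal_commutator a (contDiff_wigner hħ.ne' K), flowBracket]

end KernelProducts

/-! ### Schwartz functions on phase space -/

section SchwartzClass

/-- A function on phase space that is a Schwartz function. -/
def IsSchwartz (f : Phase N → ℂ) : Prop := ∃ F : 𝓢(Phase N, ℂ), ⇑F = f

namespace IsSchwartz

variable {f g : Phase N → ℂ}

theorem contDiff (hf : IsSchwartz f) : ContDiff ℝ ∞ f := by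
  obtain ⟨F, rfl⟩ := hf
  exact F.smooth _

theorem integrable (hf : IsSchwartz f) : Integrable f := by
  obtain ⟨F, rfl⟩ := hf
  exact F.integrable

theorem add (hf : IsSchwartz f) (hg : IsSchwartz g) : IsSchwartz fun z => f z + g z := by
  obtain ⟨F, rfl⟩ := hf
  obtain ⟨G, rfl⟩ := hg
  exact ⟨F + G, rfl⟩

theorem const_mul (c : ℂ) (hf : IsSchwartz f) : IsSchwartz fun z => c * f z := by
  obtain ⟨F, rfl⟩ := hf
  exact ⟨c • F, rfl⟩

theorem neg (hf : IsSchwartz f) : IsSchwartz fun z => -f z := by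
  simpa using hf.const_mul (-1)

theorem sub (hf : IsSchwartz f) (hg : IsSchwartz g) : IsSchwartz fun z => f z - g z := by
  simpa only [sub_eq_add_neg] using hf.add hg.neg

theorem star (hf : IsSchwartz f) : IsSchwartz fun z => conj (f z) := by
  obtain ⟨F, rfl⟩ := hf
  exact ⟨postcompCLM (𝕜 := ℝ) (Complex.conjCLE : ℂ →L[ℝ] ℂ) F, rfl⟩

theorem sum {κ : Type*} (s : Finset κ) {F : κ → Phase N → ℂ} (hF : ∀ k, IsSchwartz (F k)) :
    IsSchwartz fun z => ∑ k ∈ s, F k z := by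
  induction s using Finset.cons_induction with
  | empty => exact ⟨0, funext fun z => by simp⟩
  | cons k s hk ih => simpa only [Finset.sum_cons] using (hF k).add ih

theorem pd (i : Fin N ⊕ Fin N) (hf : IsSchwartz f) : IsSchwartz (pd i f) := by
  obtain ⟨F, rfl⟩ := hf
  exact ⟨∂_{basisVec i} F, funext fun z => lineDerivOp_apply_eq_fderiv _ _ _⟩

theorem mul_polySymbol (a : MvPolynomial (Fin N ⊕ Fin N) ℂ) (hf : IsSchwartz f) :
    IsSchwartz fun z => f z * polySymbol a z := by
  induction a using MvPolynomial.induction_on generalizing f with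
  | C c => simpa only [polySymbol_C, mul_comm] using hf.const_mul c
  | add p q hp hq => simpa only [polySymbol_add, mul_add] using (hp hf).add (hq hf)
  | mul_X p i hp =>
    obtain ⟨F, hF⟩ := hp hf
    refine ⟨mulCLM (coordCLM i) F, funext fun z => ?_⟩
    rw [mulCLM_apply, hF, polySymbol_mul, polySymbol_X]
    simp only [coord]
    ring

theorem poissonPow (l : ℕ) (a : MvPolynomial (Fin N ⊕ Fin N) ℂ) (hf : IsSchwartz f) :
    IsSchwartz (poissonPow l f (polySymbol a)) := by
  induction l generalizing f a with
  | zero => exact hf.mul_polySymbol a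
  | succ l ih =>
    rw [poissonPow_succ']
    refine IsSchwartz.sum _ fun i => IsSchwartz.const_mul _ ?_
    rw [pd_polySymbol]
    exact ih _ (hf.pd i)

theorem sincProd (ħ : ℝ) (a : MvPolynomial (Fin N ⊕ Fin N) ℂ) (hf : IsSchwartz f) :
    IsSchwartz (sincProd ħ f (polySymbol a)) := by
  obtain ⟨M, hM⟩ := exists_poissonPow_polySymbol_eq_zero a
  have h : WignerHusimi.sincProd ħ f (polySymbol a) = fun z => _ :=
    funext fun z => sincProd_eq_sum fun l hl => hM l hl f hf.contDiff z
  rw [h]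
  exact IsSchwartz.sum _ fun j => (hf.poissonPow _ a).const_mul _

theorem sincProd_pd (ħ : ℝ) (a : MvPolynomial (Fin N ⊕ Fin N) ℂ) (i : Fin N ⊕ Fin N)
    (hf : IsSchwartz f) :
    IsSchwartz (WignerHusimi.sincProd ħ f (WignerHusimi.pd i (polySymbol a))) := by
  rw [pd_polySymbol]
  exact hf.sincProd ħ _

end IsSchwartz

end SchwartzClass

/-! ### The Gaussian kernel -/

section Gaussian

/-- The unnormalized Gaussian `exp(-∑ᵢ αᵢ cᵢ²)` in the phase space coordinates `cᵢ`. -/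
def gaussian (α : Fin N ⊕ Fin N → ℝ) (z : Phase N) : ℂ :=
  Complex.exp (∑ i, -(α i : ℂ) * (coord i z * coord i z))

theorem contDiff_gaussian (α : Fin N ⊕ Fin N → ℝ) : ContDiff ℝ ∞ (gaussian α) :=
  (ContDiff.sum fun _ _ => contDiff_const.mul (contDiff_coord.mul contDiff_coord)).cexp

theorem pd_gaussian (α : Fin N ⊕ Fin N → ℝ) (i : Fin N ⊕ Fin N) :
    pd i (gaussian α) = fun z => -2 * α i * coord i z * gaussian α z := by
  have hc : ∀ j : Fin N ⊕ Fin N,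
      ContDiff ℝ ∞ fun z : Phase N => coord j z * coord j z := fun j =>
    contDiff_coord.mul contDiff_coord
  have hq : ContDiff ℝ ∞ fun z : Phase N => ∑ j, -(α j : ℂ) * (coord j z * coord j z) :=
    ContDiff.sum fun j _ => contDiff_const.mul (hc j)
  have h : pd i (gaussian α) = fun z => gaussian α z *
      pd i (fun z : Phase N => ∑ j, -(α j : ℂ) * (coord j z * coord j z)) z := by
    ext z
    have hd : HasFDerivAt (gaussian α) _ z :=
      (hq.differentiable (by simp) z).hasFDerivAt.cexp
    rw [pd, hd.fderiv]
    rfl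
  rw [h, pd_sum fun j _ => contDiff_const.mul (hc j)]
  ext z
  have : ∀ j, pd i (fun z : Phase N => -(α j : ℂ) * (coord j z * coord j z)) z =
      if i = j then -2 * α j * coord j z else 0 := fun j => by
    rw [pd_const_mul _ (hc j), pd_mul contDiff_coord contDiff_coord, pd_coord]
    split_ifs <;> ring
  simp only [this, Finset.sum_ite_eq, Finset.mem_univ, if_true]
  ring

theorem norm_gaussian (α : Fin N ⊕ Fin N → ℝ) (z : Phase N) :
    ‖gaussian α z‖ = Real.exp (∑ i, -α i * (coordCLM i z) ^ 2) := by
  rw [gaussian, Complex.norm_exp, Complex.re_sum]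
  congr 1
  refine Finset.sum_congr rfl fun i _ => ?_
  simp only [coord]
  rw [← Complex.ofReal_mul, ← Complex.ofReal_neg, ← Complex.ofReal_mul, Complex.ofReal_re, sq]

theorem exists_norm_polySymbol_mul_gaussian_le (a : MvPolynomial (Fin N ⊕ Fin N) ℂ)
    {α : Fin N ⊕ Fin N → ℝ} (hα : ∀ i, 0 < α i) :
    ∃ C, ∀ z, ‖polySymbol a z * gaussian α z‖ ≤ C := by
  have hle : ∀ (β : Fin N ⊕ Fin N → ℝ), (∀ i, 0 < β i) → ∀ j z,
      ‖gaussian β z‖ ≤ Real.exp (-β j * (coordCLM j z) ^ 2) := fun β hβ j z => by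
    rw [norm_gaussian, Real.exp_le_exp]
    have := Finset.single_le_sum (f := fun i => β i * (coordCLM i z) ^ 2)
      (fun i _ => mul_nonneg (hβ i).le (sq_nonneg _)) (Finset.mem_univ j)
    simp only [neg_mul, Finset.sum_neg_distrib]
    linarith
  induction a using MvPolynomial.induction_on generalizing α with
  | C c =>
    refine ⟨‖c‖, fun z => ?_⟩
    rw [polySymbol_C, norm_mul, norm_gaussian]
    refine mul_le_of_le_one_right (norm_nonneg _) (Real.exp_le_one_iff.2 ?_)
    exact Finset.sum_nonpos fun i _ => by
      have := mul_nonneg (hα i).le (sq_nonneg (coordCLM i z)); linarith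
  | add p q hp hq =>
    obtain ⟨C, hC⟩ := hp hα
    obtain ⟨D, hD⟩ := hq hα
    refine ⟨C + D, fun z => ?_⟩
    rw [polySymbol_add, add_mul]
    exact (norm_add_le _ _).trans (add_le_add (hC z) (hD z))
  | mul_X p j hp =>
    -- Half of the Gaussian controls `p` by induction, which is why `α` is generalized; the other
    -- half controls the new coordinate.
    have hβ : ∀ i, 0 < (fun i => α i / 2) i := fun i => half_pos (hα i)
    obtain ⟨C, hC⟩ := hp hβ
    have hsplit : ∀ z, gaussian α z =
        gaussian (fun i => α i / 2) z * gaussian (fun i => α i / 2) z := fun z => by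
      rw [gaussian, gaussian, ← Complex.exp_add, ← Finset.sum_add_distrib]
      congr 1
      refine Finset.sum_congr rfl fun i _ => ?_
      push_cast
      ring
    set β := α j / 2 with hβj
    have hβ0 : 0 < β := hβ j
    -- The constant comes from `|t| ≤ (1 + 1/β)(βt² + 1) ≤ (1 + 1/β) exp(βt²)`.
    refine ⟨C * (1 + 1 / β), fun z => ?_⟩
    have hx : ‖coord j z * gaussian (fun i => α i / 2) z‖ ≤ 1 + 1 / β := by
      set t := coordCLM j z with ht
      have h1 : β * t ^ 2 + 1 ≤ Real.exp (β * t ^ 2) := Real.add_one_le_exp _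
      have h2 : |t| ≤ (1 + 1 / β) * (β * t ^ 2 + 1) := by
        have : (1 + 1 / β) * (β * t ^ 2 + 1) = t ^ 2 + 1 + (β * t ^ 2 + 1 / β) := by
          field_simp
          ring
        rw [this]
        have h3 : 0 ≤ β * t ^ 2 + 1 / β := by positivity
        nlinarith [sq_abs t, sq_nonneg (|t| - 1), abs_nonneg t]
      calc ‖coord j z * gaussian (fun i => α i / 2) z‖
          = |t| * ‖gaussian (fun i => α i / 2) z‖ := by
            rw [norm_mul, coord, Complex.norm_real, Real.norm_eq_abs]
        _ ≤ ((1 + 1 / β) * Real.exp (β * t ^ 2)) * Real.exp (-β * t ^ 2) := by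
            gcongr
            · exact h2.trans (by gcongr)
            · exact hle _ hβ j z
        _ = 1 + 1 / β := by
            rw [mul_assoc, ← Real.exp_add]
            simp
    rw [polySymbol_mul, polySymbol_X, hsplit]
    calc ‖polySymbol p z * coord j z *
          (gaussian (fun i => α i / 2) z * gaussian (fun i => α i / 2) z)‖
        = ‖polySymbol p z * gaussian (fun i => α i / 2) z‖ *
          ‖coord j z * gaussian (fun i => α i / 2) z‖ := by
          rw [← norm_mul]
          congr 1
          ring
      _ ≤ C * (1 + 1 / β) :=
          mul_le_mul (hC z) hx (norm_nonneg _) ((norm_nonneg _).trans (hC z))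

theorem isSchwartz_gaussian {α : Fin N ⊕ Fin N → ℝ} (hα : ∀ i, 0 < α i) :
    IsSchwartz (gaussian α) := by
  refine exists_schwartzMap_phase (S := Set.range fun a : MvPolynomial (Fin N ⊕ Fin N) ℂ =>
    fun z => polySymbol a z * gaussian α z) ?_ ?_ ?_ ?_ ⟨1, by simp [polySymbol_one]⟩
  · rintro _ ⟨a, rfl⟩
    exact exists_norm_polySymbol_mul_gaussian_le a hα
  · rintro _ ⟨a, rfl⟩ i
    refine ⟨MvPolynomial.X i * a, funext fun z => ?_⟩
    simp only [polySymbol_X_mul, coord]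
    ring
  · rintro _ ⟨a, rfl⟩
    exact ((contDiff_polySymbol a).mul (contDiff_gaussian α)).differentiable (by simp)
  · rintro _ ⟨a, rfl⟩ i
    refine ⟨MvPolynomial.pderiv i a + MvPolynomial.C (-2 * (α i : ℂ)) * (MvPolynomial.X i * a),
      ?_⟩
    beta_reduce
    rw [pd_mul (contDiff_polySymbol a) (contDiff_gaussian α), pd_gaussian, polySymbol_add,
      polySymbol_C_mul, polySymbol_X_mul, pd_polySymbol]
    ext z
    ring

theorem isSchwartz_gaussKernel {σp σx : Fin N → ℝ} (hp : ∀ n, σp n ≠ 0) (hx : ∀ n, σx n ≠ 0) :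
    IsSchwartz fun z => (gaussKernel σp σx z : ℂ) := by
  set α : Fin N ⊕ Fin N → ℝ :=
    Sum.elim (fun n => 1 / (2 * σp n ^ 2)) (fun n => 1 / (2 * σx n ^ 2)) with hα
  have h : ∀ i, 0 < α i := by
    rintro (n | n)
    · have := hp n
      simp only [hα, Sum.elim_inl]
      positivity
    · have := hx n
      simp only [hα, Sum.elim_inr]
      positivity
  convert (isSchwartz_gaussian h).const_mul
    ((∏ n, 1 / (2 * Real.pi * σp n * σx n) : ℝ) : ℂ) using 2 with z
  rw [gaussKernel, Finset.prod_mul_distrib, ← Real.exp_sum, Complex.ofReal_mul,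
    Complex.ofReal_exp, gaussian, Fintype.sum_sum_type, ← Finset.sum_add_distrib]
  congr 3
  push_cast
  refine Finset.sum_congr rfl fun n _ => ?_
  simp only [hα, Sum.elim_inl, Sum.elim_inr, coord, coordCLM_inl, coordCLM_inr]
  push_cast
  ring

end Gaussian

/-! ### Convolution with the Gaussian kernel -/

section Convolution

/-- A bounded derivative of `f` times the integrable `g` dominates. The derivative is placed on `f`,
which becomes the Wigner flow, so that convolution commutes with its partial derivatives. -/
theorem hasFDerivAt_schwartz_convolution (f g : 𝓢(Phase N, ℂ)) (z : Phase N) :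
    Integrable (fun u => g u • fderiv ℝ f (z - u)) ∧
      HasFDerivAt (fun z => ∫ u, f (z - u) * g u) (∫ u, g u • fderiv ℝ f (z - u)) z := by
  set C := SchwartzMap.seminorm ℝ 0 0 (fderivCLM ℝ (Phase N) ℂ f)
  have hC : ∀ z, ‖fderiv ℝ f z‖ ≤ C := fun z =>
    norm_le_seminorm ℝ (fderivCLM ℝ (Phase N) ℂ f) z
  have hb : ∀ (z u : Phase N), ‖g u • fderiv ℝ f (z - u)‖ ≤ ‖g u‖ * C := fun z u => by
    rw [norm_smul]
    gcongr
    exact hC _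
  have hgi : Integrable fun u => ‖g u‖ * C := g.integrable.norm.mul_const C
  have hcont : Continuous fun u => g u • fderiv ℝ f (z - u) :=
    g.continuous.smul ((fderivCLM ℝ (Phase N) ℂ f).continuous.comp (by fun_prop))
  have hc : ∀ z : Phase N, Continuous fun u => f (z - u) * g u := fun z =>
    (f.continuous.comp (by fun_prop)).mul g.continuous
  refine ⟨hgi.mono' hcont.aestronglyMeasurable (.of_forall (hb z)),
    hasFDerivAt_integral_of_dominated_of_fderiv_le Filter.univ_mem
      (.of_forall fun z => (hc z).aestronglyMeasurable) ?_ hcont.aestronglyMeasurable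
      (.of_forall fun u z _ => hb z u) hgi (.of_forall fun u z _ => ?_)⟩
  · refine g.integrable.bdd_mul (c := SchwartzMap.seminorm ℝ 0 0 f)
      (f.continuous.comp (by fun_prop)).aestronglyMeasurable
      (.of_forall fun u => norm_le_seminorm ℝ f _)
  · have h := ((f.hasFDerivAt (z - u)).comp z ((hasFDerivAt_id z).sub_const u)).mul_const (g u)
    refine h.congr_fderiv ?_
    ext <;> simp

variable {σp σx : Fin N → ℝ}

instance instIsNegInvariantPhase : (volume : Measure (Phase N)).IsNegInvariant :=
  Measure.IsAddHaarMeasure.isNegInvariant_of_regular _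

theorem gaussConv_eq (f : Phase N → ℂ) (z : Phase N) :
    gaussConv σp σx f z = ∫ u, f (z - u) * (gaussKernel σp σx u : ℂ) := by
  rw [gaussConv, ← integral_sub_left_eq_self _ _ z]
  simp only [sub_sub_cancel]


theorem differentiable_gaussConv (hp : ∀ n, σp n ≠ 0) (hx : ∀ n, σx n ≠ 0)
    {f : Phase N → ℂ} (hf : IsSchwartz f) :
    Differentiable ℝ (gaussConv σp σx f) := by
  obtain ⟨F, rfl⟩ := hf
  obtain ⟨G, hG⟩ := isSchwartz_gaussKernel hp hx
  rw [funext (gaussConv_eq (σp := σp) (σx := σx) F)]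
  intro z
  have := (hasFDerivAt_schwartz_convolution F G z).2.differentiableAt
  rwa [hG] at this

theorem pd_gaussConv (hp : ∀ n, σp n ≠ 0) (hx : ∀ n, σx n ≠ 0)
    {f : Phase N → ℂ} (hf : IsSchwartz f) (i : Fin N ⊕ Fin N) (z : Phase N) :
    pd i (gaussConv σp σx f) z = gaussConv σp σx (pd i f) z := by
  obtain ⟨F, rfl⟩ := hf
  obtain ⟨G, hG⟩ := isSchwartz_gaussKernel hp hx
  obtain ⟨hi, hd⟩ := hasFDerivAt_schwartz_convolution F G z
  rw [hG] at hd
  rw [gaussConv_eq, pd, funext (gaussConv_eq (σp := σp) (σx := σx) F), hd.fderiv,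
    ContinuousLinearMap.integral_apply (by rwa [hG] at hi)]
  refine integral_congr_ae (.of_forall fun u => ?_)
  simp only [pd, FunLike.coe_smul, Pi.smul_apply, smul_eq_mul]
  ring

/-- The Gaussian is even, so this is a translate of it. Smoothing at a point thereby becomes pairing
with one Schwartz function, the form needed for duality. -/
theorem exists_schwartzMap_gaussKernel_sub (hp : ∀ n, σp n ≠ 0) (hx : ∀ n, σx n ≠ 0)
    (z : Phase N) :
    ∃ g : 𝓢(Phase N, ℂ), ∀ u, g u = (gaussKernel σp σx (z - u) : ℂ) := by
  obtain ⟨G, hG⟩ := isSchwartz_gaussKernel hp hx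
  refine ⟨compSubConstCLM ℂ z G, fun u => ?_⟩
  rw [compSubConstCLM_apply, hG, Complex.ofReal_inj]
  unfold gaussKernel
  refine Finset.prod_congr rfl fun n _ => ?_
  rw [Prod.fst_sub, Prod.fst_sub, Prod.snd_sub, Prod.snd_sub, PiLp.sub_apply, PiLp.sub_apply,
    PiLp.sub_apply, PiLp.sub_apply, sub_sq_comm, sub_sq_comm (u.2 n)]

theorem integrable_mul_gaussKernel (hp : ∀ n, σp n ≠ 0) (hx : ∀ n, σx n ≠ 0)
    {f : Phase N → ℂ} (hf : IsSchwartz f) (z : Phase N) :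
    Integrable fun u => f u * (gaussKernel σp σx (z - u) : ℂ) := by
  obtain ⟨F, rfl⟩ := hf
  obtain ⟨g, hg⟩ := exists_schwartzMap_gaussKernel_sub hp hx z
  simp only [← hg]
  exact g.integrable.bdd_mul F.continuous.aestronglyMeasurable
    (.of_forall fun u => norm_le_seminorm ℝ F _)

theorem gaussConv_divergence (hp : ∀ n, σp n ≠ 0) (hx : ∀ n, σx n ≠ 0)
    {Jp Jx : Fin N → Phase N → ℂ} (hJp : ∀ n, IsSchwartz (Jp n))
    (hJx : ∀ n, IsSchwartz (Jx n)) (z : Phase N) :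
    gaussConv σp σx (divergence Jp Jx) z =
      divergence (fun n => gaussConv σp σx (Jp n)) (fun n => gaussConv σp σx (Jx n)) z := by
  have hi : ∀ (J : Fin N → Phase N → ℂ), (∀ n, IsSchwartz (J n)) → ∀ i n,
      Integrable fun u => pd i (J n) u * (gaussKernel σp σx (z - u) : ℂ) := fun J hJ i n =>
    integrable_mul_gaussKernel hp hx ((hJ n).pd i) z
  simp only [divergence, dp_eq_pd, dx_eq_pd]
  simp only [pd_gaussConv hp hx (hJp _), pd_gaussConv hp hx (hJx _)]
  simp only [gaussConv, divergence, dp_eq_pd, dx_eq_pd, add_mul, Finset.sum_mul]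
  rw [integral_add (integrable_finsetSum _ fun n _ => hi Jp hJp _ n)
    (integrable_finsetSum _ fun n _ => hi Jx hJx _ n),
    integral_finsetSum _ fun n _ => hi Jp hJp _ n,
    integral_finsetSum _ fun n _ => hi Jx hJx _ n]

end Convolution

/-! ### Duality between Wigner functions and kernels -/

section Duality

/-- A Schwartz function on a product with its arguments exchanged. -/
def swapArgs (f : 𝓢(Config N × Config N, ℂ)) : 𝓢(Config N × Config N, ℂ) :=
  compCLMOfContinuousLinearEquiv ℂ (ContinuousLinearEquiv.prodComm ℝ (Config N) (Config N)) f

theorem swapArgs_apply (f : 𝓢(Config N × Config N, ℂ)) (x y : Config N) :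
    swapArgs f (x, y) = f (y, x) := rfl

theorem integrable_schwartz_mul (f g : 𝓢(Config N × Config N, ℂ)) :
    Integrable fun w => f w * g w :=
  g.integrable.bdd_mul f.continuous.aestronglyMeasurable
    (.of_forall fun w => norm_le_seminorm ℝ f w)

/-- The partial Fourier transform can be moved to the other factor of an integral. -/
theorem integral_pft_mul {ħ : ℝ} (hħ : ħ ≠ 0) (f g : 𝓢(Config N × Config N, ℂ)) :
    ∫ z : Phase N, pft ħ f z * g z =
      ∫ w : Config N × Config N, f w * pft ħ (swapArgs g) (w.2, w.1) := by
  set F : Phase N → Config N → ℂ := fun z ξ =>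
    f (z.2, ξ) * Complex.exp (-Complex.I * (inner ℝ z.1 ξ / ħ : ℝ)) * g z with hF
  obtain ⟨b, hb, hle⟩ := exists_integrable_bound f 0
  have hle' : ∀ z ξ, ‖F z ξ‖ ≤ ‖g z‖ * b ξ := fun z ξ => by
    have := hle z.2 ξ
    rw [pow_zero, one_mul] at this
    rw [hF]
    beta_reduce
    rw [norm_mul, norm_mul, norm_exp_neg_I_mul, mul_one, mul_comm]
    gcongr
  have hFc : Continuous (Function.uncurry F) := by
    rw [hF]
    unfold Function.uncurry
    fun_prop
  have hint : Integrable (Function.uncurry F) ((volume : Measure (Phase N)).prod volume) :=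
    (g.integrable.norm.mul_prod hb).mono' hFc.aestronglyMeasurable
      (.of_forall fun z => hle' z.1 z.2)
  have hξ : ∀ ξ, Integrable (fun z => F z ξ) (volume : Measure (Phase N)) := fun ξ =>
    (g.integrable.norm.mul_const (b ξ)).mono'
      (hFc.comp (by fun_prop : Continuous fun z : Phase N => (z, ξ))).aestronglyMeasurable
      (.of_forall fun z => hle' z ξ)
  -- Integrating over `p` first transforms `g` in its momentum. Since `pft` acts on the second
  -- argument and the momentum is the first, the arguments are exchanged.
  have hG : ∀ x ξ, f (x, ξ) * pft ħ (swapArgs g) (ξ, x) = ∫ p, F (p, x) ξ := fun x ξ => by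
    rw [pft, ← integral_const_mul]
    congr with p
    rw [hF]
    simp only [swapArgs_apply, real_inner_comm]
    ring
  obtain ⟨G, hGs⟩ := exists_schwartzMap_pft hħ (swapArgs g)
  have hfG : Integrable (fun w : Config N × Config N => f w * pft ħ (swapArgs g) (w.2, w.1))
      ((volume : Measure (Config N)).prod volume) := by
    have := integrable_schwartz_mul f (swapArgs G)
    rw [← hGs]
    exact this
  calc ∫ z : Phase N, pft ħ f z * g z = ∫ z : Phase N, ∫ ξ, F z ξ := by
        simp only [pft, ← integral_mul_const, hF]
    _ = ∫ ξ, ∫ z : Phase N, F z ξ := integral_integral_swap hint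
    _ = ∫ ξ, ∫ x, ∫ p, F (p, x) ξ := by
        congr with ξ
        exact integral_prod_symm _ (hξ ξ)
    _ = ∫ ξ, ∫ x, f (x, ξ) * pft ħ (swapArgs g) (ξ, x) := by simp only [hG]
    _ = _ := (integral_prod_symm _ hfG).symm

/-- Uniqueness of Haar measure replaces a determinant; the value of `c` is immaterial, as it is
absorbed into the dual test function. -/
theorem exists_integral_comp_midpointEquiv (N : ℕ) : ∃ c : ℝ, ∀ f : Config N × Config N → ℂ,
    ∫ w, f (midpointEquiv N w) = c * ∫ w, f w := by
  have := (midpointEquiv N).isAddHaarMeasure_map (volume : Measure (Config N × Config N))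
  obtain ⟨c, hc⟩ : ∃ c : NNReal, Measure.map (midpointEquiv N) volume = c • volume :=
    ⟨_, Measure.isAddLeftInvariant_eq_smul _ volume⟩
  refine ⟨c, fun f => ?_⟩
  have h : ∫ w, f w ∂(Measure.map (midpointEquiv N) volume) = ∫ w, f (midpointEquiv N w) :=
    (midpointEquiv N).toHomeomorph.measurableEmbedding.integral_map (μ := volume) f
  rw [← h, hc, integral_smul_nnreal_measure]
  rfl

/-- Integration of Wigner functions against a Schwartz function is given by integration of kernels
against a Schwartz function. -/
theorem exists_integral_wigner_mul {ħ : ℝ} (hħ : ħ ≠ 0) (g : 𝓢(Phase N, ℂ)) :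
    ∃ Φ : 𝓢(Config N × Config N, ℂ), ∀ K : 𝓢(Config N × Config N, ℂ),
      ∫ z, wigner ħ K z * g z = ∫ w, K w * Φ w := by
  obtain ⟨G, hG⟩ := exists_schwartzMap_pft hħ (swapArgs g)
  obtain ⟨c, hc⟩ := exists_integral_comp_midpointEquiv N
  set Φ : 𝓢(Config N × Config N, ℂ) :=
    compCLMOfContinuousLinearEquiv ℂ (midpointEquiv N).symm (swapArgs G) with hΦ
  set C : ℂ := ((1 / (2 * Real.pi * ħ : ℝ) ^ N : ℝ) : ℂ) with hC
  refine ⟨(C * c) • Φ, fun K => ?_⟩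
  have h1 : ∀ w, toMidpoint K w * pft ħ (swapArgs g) (w.2, w.1) =
      (fun w => K w * Φ w) (midpointEquiv N w) := fun w => by
    rw [← hG, hΦ]
    simp only [compCLMOfContinuousLinearEquiv_apply, Function.comp_apply,
      ContinuousLinearEquiv.symm_apply_apply]
    rfl
  calc ∫ z, wigner ħ K z * g z = C * ∫ z, pft ħ (toMidpoint K) z * g z := by
        rw [wigner_eq_pft, ← integral_const_mul]
        simp only [mul_assoc, hC]
    _ = C * (c * ∫ w, K w * Φ w) := by
        rw [integral_pft_mul hħ]
        simp only [h1]
        rw [hc fun w => K w * Φ w]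
    _ = _ := by
        rw [← mul_assoc, ← integral_const_mul]
        congr with w
        simp only [smul_apply, smul_eq_mul]
        ring

end Duality

/-! ### The continuity equation -/

section Continuity

theorem wigner_sum (ħ : ℝ) {ι : Type*} (s : Finset ι) (K : ι → 𝓢(Config N × Config N, ℂ))
    (z : Phase N) : wigner ħ (∑ k ∈ s, K k : 𝓢(Config N × Config N, ℂ)) z =
      ∑ k ∈ s, wigner ħ (K k) z := by
  induction s using Finset.cons_induction with
  | empty => simpa using wigner_smul ħ 0 (0 : 𝓢(Config N × Config N, ℂ)) z
  | cons k s hk ih => rw [Finset.sum_cons, Finset.sum_cons, wigner_add, ih]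

variable {ι : Type*} [Fintype ι] {ħ : ℝ}

/-- The right-hand side of the master equation is a Schwartz kernel, and its Wigner function is a
sum of brackets. -/
theorem exists_lindbladRHS (hħ : 0 < ħ) (H : MvPolynomial (Fin N ⊕ Fin N) ℂ)
    (L : ι → MvPolynomial (Fin N ⊕ Fin N) ℂ) (ρ : 𝓢(Config N × Config N, ℂ)) :
    ∃ R : 𝓢(Config N × Config N, ℂ),
      ⇑R = lindbladRHS ħ (polySymbol H) (fun k => polySymbol (L k)) ρ ∧
      ∀ z, wigner ħ R z = -flowBracket ħ (wigner ħ ρ) (polySymbol H) z +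
        ∑ k, (Complex.I * ħ / 2 * flowBracket ħ (moyal ħ (polySymbol (L k)) (wigner ħ ρ))
            (symbolAdjoint (polySymbol (L k))) z +
          conj (Complex.I * ħ / 2 * flowBracket ħ (moyal ħ (polySymbol (L k)) (wigner ħ ρ))
            (symbolAdjoint (polySymbol (L k))) z)) := by
  obtain ⟨C₀, h₀, w₀⟩ := exists_kerCommutator hħ H ρ
  choose M hM wM using fun k => exists_opMulKer hħ (L k) ρ
  choose C hC wC using fun k =>
    exists_kerCommutator hħ (MvPolynomial.map (starRingEnd ℂ) (L k)) (M k)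
  -- Each commutator contributes a factor `iħ`: the Hamiltonian term gets `(i/ħ)(iħ) = -1`, each
  -- dissipative term `½ iħ`. Adjoint kernels turn `h.c.` into `c.c.`
  refine ⟨(Complex.I / ħ : ℂ) • C₀ + (1 / 2 : ℂ) • ∑ k, (C k + adjointKernel (C k)),
    funext fun w => ?_, fun z => ?_⟩
  · simp only [add_apply, smul_apply, sum_apply, coe_adjointKernel, h₀, hC, hM, lindbladRHS,
      symbolAdjoint_polySymbol, smul_eq_mul]
  · have hc : (ħ : ℂ) ≠ 0 := by exact_mod_cast hħ.ne'
    simp only [wigner_add, wigner_smul, wigner_sum, coe_adjointKernel, wigner_kerAdjoint, w₀, wC,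
      wM, symbolAdjoint_polySymbol, Finset.mul_sum]
    congr 1
    · field_simp
      rw [Complex.I_sq]
      ring
    · refine Finset.sum_congr rfl fun k _ => ?_
      simp only [map_mul, map_div₀, Complex.conj_I, Complex.conj_ofReal, map_ofNat]
      ring

variable {H : MvPolynomial (Fin N ⊕ Fin N) ℂ} {L : ι → MvPolynomial (Fin N ⊕ Fin N) ℂ}

theorem isSchwartz_lindblad_sum {F : ι → Phase N → ℂ} (hF : ∀ k, IsSchwartz (F k))
    (i : Fin N ⊕ Fin N) : IsSchwartz fun z => ∑ k, (Complex.I * ħ / 2 *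
      sincProd ħ (F k) (pd i (symbolAdjoint (polySymbol (L k)))) z +
      conj (Complex.I * ħ / 2 *
        sincProd ħ (F k) (pd i (symbolAdjoint (polySymbol (L k)))) z)) := by
  refine IsSchwartz.sum _ fun k => ?_
  rw [symbolAdjoint_polySymbol]
  have h := ((hF k).sincProd_pd ħ (MvPolynomial.map (starRingEnd ℂ) (L k)) i).const_mul
    (Complex.I * ħ / 2)
  exact h.add h.star

theorem pd_lindblad_sum {F : ι → Phase N → ℂ} (hF : ∀ k, IsSchwartz (F k))
    (i j : Fin N ⊕ Fin N) : pd j (fun z => ∑ k, (Complex.I * ħ / 2 *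
      sincProd ħ (F k) (pd i (symbolAdjoint (polySymbol (L k)))) z +
      conj (Complex.I * ħ / 2 *
        sincProd ħ (F k) (pd i (symbolAdjoint (polySymbol (L k)))) z))) = fun z =>
      ∑ k, (Complex.I * ħ / 2 *
        pd j (sincProd ħ (F k) (pd i (symbolAdjoint (polySymbol (L k))))) z +
      conj (Complex.I * ħ / 2 *
        pd j (sincProd ħ (F k) (pd i (symbolAdjoint (polySymbol (L k))))) z)) := by
  have h0 : ∀ k, IsSchwartz (sincProd ħ (F k) (pd i (symbolAdjoint (polySymbol (L k))))) :=
    fun k => by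
      rw [symbolAdjoint_polySymbol]
      exact (hF k).sincProd_pd ħ _ i
  have h := fun k => (h0 k).const_mul (Complex.I * ħ / 2)
  rw [pd_sum fun k _ => ((h k).add (h k).star).contDiff]
  ext z
  refine Finset.sum_congr rfl fun k _ => ?_
  rw [pd_add (h k).contDiff (h k).star.contDiff, pd_conj, pd_const_mul _ (h0 k).contDiff]

variable {W : Phase N → ℂ}

theorem isSchwartz_wignerFlowP (hW : IsSchwartz W)
    (hL : ∀ k, IsSchwartz (moyal ħ (polySymbol (L k)) W)) (n : Fin N) :
    IsSchwartz (wignerFlowP ħ (polySymbol H) (fun k => polySymbol (L k)) W n) :=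
  (hW.sincProd_pd ħ H (Sum.inr n)).neg.add (isSchwartz_lindblad_sum hL (Sum.inr n))

theorem isSchwartz_wignerFlowX (hW : IsSchwartz W)
    (hL : ∀ k, IsSchwartz (moyal ħ (polySymbol (L k)) W)) (n : Fin N) :
    IsSchwartz (wignerFlowX ħ (polySymbol H) (fun k => polySymbol (L k)) W n) :=
  (hW.sincProd_pd ħ H (Sum.inl n)).sub (isSchwartz_lindblad_sum hL (Sum.inl n))

theorem pd_neg {f : Phase N → ℂ} {i : Fin N ⊕ Fin N} (hf : ContDiff ℝ ∞ f) :
    pd i (fun z => -f z) = fun z => -pd i f z := by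
  simpa using pd_const_mul (i := i) (-1) hf

theorem pd_sub {f g : Phase N → ℂ} {i : Fin N ⊕ Fin N} (hf : ContDiff ℝ ∞ f)
    (hg : ContDiff ℝ ∞ g) : pd i (fun z => f z - g z) = fun z => pd i f z - pd i g z := by
  simp only [sub_eq_add_neg]
  rw [pd_add hf hg.neg, pd_neg hg]

/-- The divergence of the Wigner flow. -/
theorem divergence_wignerFlow (hW : IsSchwartz W)
    (hL : ∀ k, IsSchwartz (moyal ħ (polySymbol (L k)) W)) (z : Phase N) :
    divergence (wignerFlowP ħ (polySymbol H) (fun k => polySymbol (L k)) W)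
        (wignerFlowX ħ (polySymbol H) (fun k => polySymbol (L k)) W) z =
      flowBracket ħ W (polySymbol H) z -
        ∑ k, (Complex.I * ħ / 2 * flowBracket ħ (moyal ħ (polySymbol (L k)) W)
            (symbolAdjoint (polySymbol (L k))) z +
          conj (Complex.I * ħ / 2 * flowBracket ħ (moyal ħ (polySymbol (L k)) W)
            (symbolAdjoint (polySymbol (L k))) z)) := by
  have hH := fun i => (hW.sincProd_pd ħ H i).contDiff
  have hS := fun i => (isSchwartz_lindblad_sum (ħ := ħ) (L := L) hL i).contDiff
  have hP : ∀ n, pd (Sum.inl n)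
      (wignerFlowP ħ (polySymbol H) (fun k => polySymbol (L k)) W n) = _ := fun n =>
    (pd_add (hH (Sum.inr n)).neg (hS (Sum.inr n))).trans
      (by rw [pd_neg (hH (Sum.inr n)), pd_lindblad_sum hL])
  have hX : ∀ n, pd (Sum.inr n)
      (wignerFlowX ħ (polySymbol H) (fun k => polySymbol (L k)) W n) = _ := fun n =>
    (pd_sub (hH (Sum.inl n)) (hS (Sum.inl n))).trans (by rw [pd_lindblad_sum hL])
  simp only [divergence, flowBracket, dp_eq_pd, dx_eq_pd, hP, hX]
  simp only [Finset.sum_add_distrib, Finset.sum_neg_distrib, mul_sub, map_sub,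
    map_sum, map_mul, Finset.mul_sum, Finset.sum_sub_distrib]
  simp only [Finset.sum_comm (s := (Finset.univ : Finset (Fin N)))
    (t := (Finset.univ : Finset ι))]
  ring

end Continuity

end WignerHusimi

end

/-! ### The theorem, by testing the master equation against the dual of a shifted Gaussian -/

open WignerHusimi in
theorem theorem2 {N : ℕ} {ι : Type*} [Fintype ι] (ħ : ℝ) (hħ : 0 < ħ)
    (σp σx : Fin N → ℝ) (hσ : ∀ n, ħ / 2 < σp n * σx n)
    (I : Set ℝ)
    (H : ℝ → MvPolynomial (Fin N ⊕ Fin N) ℝ)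
    (L : ι → ℝ → MvPolynomial (Fin N ⊕ Fin N) ℂ)
    (ρ : ℝ → 𝓢(WignerHusimi.Config N × WignerHusimi.Config N, ℂ))
    (hρ : WignerHusimi.MasterEquation ħ I (fun t => WignerHusimi.polySymbol (H t))
      (fun k t => WignerHusimi.polySymbol (L k t)) ρ) :
    ∀ t ∈ I,
      -- the Wigner function and the Wigner flow are integrable, so the convolutions converge
      Integrable (WignerHusimi.wigner ħ (ρ t)) ∧
      (∀ n,
        Integrable (WignerHusimi.wignerFlowP ħ (WignerHusimi.polySymbol (H t))
          (fun k => WignerHusimi.polySymbol (L k t)) (WignerHusimi.wigner ħ (ρ t)) n) ∧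
        Integrable (WignerHusimi.wignerFlowX ħ (WignerHusimi.polySymbol (H t))
          (fun k => WignerHusimi.polySymbol (L k t)) (WignerHusimi.wigner ħ (ρ t)) n)) ∧
      -- the Husimi flow is differentiable, so its divergence makes sense
      (∀ n,
        Differentiable ℝ (WignerHusimi.husimiFlowP ħ σp σx (WignerHusimi.polySymbol (H t))
          (fun k => WignerHusimi.polySymbol (L k t)) (ρ t) n) ∧
        Differentiable ℝ (WignerHusimi.husimiFlowX ħ σp σx (WignerHusimi.polySymbol (H t))
          (fun k => WignerHusimi.polySymbol (L k t)) (ρ t) n)) ∧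
      -- the continuity equation for the generalized Husimi function
      ∀ z : WignerHusimi.Phase N,
        HasDerivWithinAt (fun s => WignerHusimi.husimi ħ σp σx (ρ s) z)
          (-WignerHusimi.divergence
            (WignerHusimi.husimiFlowP ħ σp σx (WignerHusimi.polySymbol (H t))
              (fun k => WignerHusimi.polySymbol (L k t)) (ρ t))
            (WignerHusimi.husimiFlowX ħ σp σx (WignerHusimi.polySymbol (H t))
              (fun k => WignerHusimi.polySymbol (L k t)) (ρ t)) z) I t := by
  intro t ht
  -- The uncertainty bound makes each product `σp n * σx n` positive; nonzero widths are what make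
  -- the Gaussian a Schwartz function.
  have hne : ∀ n, σp n ≠ 0 ∧ σx n ≠ 0 := fun n =>
    mul_ne_zero_iff.1 ((half_pos hħ).trans (hσ n)).ne'
  have hp := fun n => (hne n).1
  have hx := fun n => (hne n).2
  have hW : IsSchwartz (wigner ħ (ρ t)) := exists_schwartzMap_wigner hħ.ne' (ρ t)
  have hL : ∀ k, IsSchwartz (moyal ħ (polySymbol (L k t)) (wigner ħ (ρ t))) := fun k => by
    obtain ⟨M, -, hM⟩ := exists_opMulKer hħ (L k t) (ρ t)
    exact hM ▸ exists_schwartzMap_wigner hħ.ne' M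
  have hP := fun n => isSchwartz_wignerFlowP
    (H := MvPolynomial.map (algebraMap ℝ ℂ) (H t)) hW hL n
  have hX := fun n => isSchwartz_wignerFlowX
    (H := MvPolynomial.map (algebraMap ℝ ℂ) (H t)) hW hL n
  have hdiv := divergence_wignerFlow
    (H := MvPolynomial.map (algebraMap ℝ ℂ) (H t)) hW hL
  obtain ⟨R, hR, hRW⟩ := exists_lindbladRHS hħ
    (MvPolynomial.map (algebraMap ℝ ℂ) (H t)) (fun k => L k t) (ρ t)
  rw [polySymbol_map_algebraMap] at hP hX hdiv hR hRW
  refine ⟨hW.integrable, fun n => ⟨(hP n).integrable, (hX n).integrable⟩, fun n =>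
    ⟨differentiable_gaussConv hp hx (hP n), differentiable_gaussConv hp hx (hX n)⟩, fun z => ?_⟩
  obtain ⟨g, hg⟩ := exists_schwartzMap_gaussKernel_sub hp hx z
  obtain ⟨Φ, hΦ⟩ := exists_integral_wigner_mul hħ.ne' g
  -- One test function `Φ` serves all kernels at the given `z`: `ρ s` for every `s`, and the
  -- right-hand side `R`.
  have hQ : ∀ K : 𝓢(Config N × Config N, ℂ),
      gaussConv σp σx (wigner ħ K) z = ∫ w, K w * Φ w := fun K => by
    rw [← hΦ, gaussConv]
    simp only [hg]
  have hder := hρ t ht Φ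
  rw [← hR, ← hQ R] at hder
  have hneg : wigner ħ R = fun z => -divergence
      (wignerFlowP ħ (polySymbol (H t)) (fun k => polySymbol (L k t)) (wigner ħ (ρ t)))
      (wignerFlowX ħ (polySymbol (H t)) (fun k => polySymbol (L k t)) (wigner ħ (ρ t))) z := by
    ext z
    rw [hRW, hdiv]
    ring
  have hval : gaussConv σp σx (wigner ħ R) z = -divergence
      (husimiFlowP ħ σp σx (polySymbol (H t)) (fun k => polySymbol (L k t)) (ρ t))
      (husimiFlowX ħ σp σx (polySymbol (H t)) (fun k => polySymbol (L k t)) (ρ t)) z := by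
    refine Eq.trans ?_ (congrArg Neg.neg (gaussConv_divergence hp hx hP hX z))
    rw [hneg, gaussConv, gaussConv, ← integral_neg]
    simp only [neg_mul]
  rw [hval] at hder
  simpa only [husimi, hQ] using hder
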